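/- Let $n\ge 1$ and let $\Omega$ be a star graph with $n$ edges, edge $i$ being parametrized by $[0,\ell_i]$, $\ell_i>0$, with $0$ the common vertex. Let $V_i\in L^1(0,\ell_i)$ be potentials and let $\Gamma$ be given by $n\times n$ complex matrices $\alpha_1,\alpha_2,\beta_1,\beta_2$ with $\beta_1,\beta_2$ diagonal, $\operatorname{rank}[\alpha_1\ \alpha_2]=\operatorname{rank}[\beta_1\ \beta_2]=n$, $\alpha_1\alpha_2^*=\alpha_2\alpha_1^*$, $\beta_1\beta_2^*=\beta_2\beta_1^*$. For $u=(u_1,\dots,u_n)$ put $\gamma_\Gamma u=\bigl(\beta_1u(\ell)+\beta_2u'(\ell),\ \alpha_1u(0)+\alpha_2u'(0)\bigr)\in\mathbb C^{2n}$. Let $H^\Omega u=(-u_i''+V_iu_i)_i$, and let $H^\Omega_\Gamma$ be the operator $u\mapsto H^\Omega u$ in $L^2(\Omega)$ on the domain of all $u$ with $u_i,u_i'$ absolutely continuous on $[0,\ell_i]$, $H^\Omega u\in L^2(\Omega)$ and $\gamma_\Gamma u=0$ (for $V_i\in L^2$ this is $\{u\in H^2(\Omega):\gamma_\Gamma u=0\}$);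 $\rho(H^\Omega_\Gamma)$ is its resolvent set. For $\lambda\in\mathbb C$ let $Y$, $Z$ be the $n\times n$ matrices whose columns solve $(H^\Omega-\lambda)u=0$ with $Y(0)=-\alpha_2^*$, $Y'(0)=\alpha_1^*$, $Z(\ell)=-\beta_2^*$, $Z'(\ell)=\beta_1^*$. The Evans function is $$E^\Omega_\Gamma(\lambda)=\det\begin{pmatrix}Y&Z\\ Y'&Z'\end{pmatrix},$$ which does not depend on the points of the edges at which the rows are evaluated. The same definitions are used for stars whose edges are other compact intervals, the left endpoints taking the role of $0$. Cut $\Omega$ at a point $0<s_1<\ell_{j_1}$ of edge $j_1$ into $\Omega_1=[s_1,\ell_{j_1}]$ and the star $\Omega_2$ obtained by shortening edge $j_1$ to $[0,s_1]$. Cut $\Omega_2$ at an interior point $s_2>0$ of one of its edges, edge $j_2$ (so $s_2<s_1$ if $j_2=j_1$ and $s_2<\ell_{j_2}$ otherwise), into $\tilde\Omega_1$, the part of that edge beyond $s_2$, and $\tilde\Omega_2$, the star with edge $j_2$ shortened to $[0,s_2]$. The conditions $\Gamma_1,\tilde\Gamma_1,\tilde\Gamma_2$ on $\Omega_1,\tilde\Omega_1,\tilde\Omega_2$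 are those of $\Gamma$ at the old vertices and Dirichlet conditions ($u=0$) at the cuts. Let $$\lambda\in\rho(H^{\Omega_1}_{\Gamma_1})\cap\rho(H^{\tilde\Omega_1}_{\tilde\Gamma_1})\cap\rho(H^{\tilde\Omega_2}_{\tilde\Gamma_2}).$$ Define maps $\mathcal M_1,\mathcal M_2:\mathbb C^2\to\mathbb C^2$ as follows; all functions solve $(H-\lambda)u=0$ on the indicated piece and satisfy the homogeneous conditions at those vertices at which no value is prescribed. * If $j_1=j_2=j$: $\mathcal M_1f=(u'(s_1),-u'(s_2))$ where $u$ is the solution on $\tilde\Omega_1=[s_2,s_1]$ with $u(s_1)=f_1$, $u(s_2)=f_2$; and $\mathcal M_2f=(-u'(s_1),w_j'(s_2))$ where $u$ is the solution on $\Omega_1$ with $u(s_1)=f_1$ and $w$ the solution on $\tilde\Omega_2$ with $w_j(s_2)=f_2$. * If $j_1\ne j_2$: $\mathcal M_1f=(-u'(s_1),-w'(s_2))$ where $u$ is the solution on $\Omega_1$ with $u(s_1)=f_1$ and $w$ the solution on $\tilde\Omega_1$ with $w(s_2)=f_2$; and $\mathcal M_2f=(u_{j_1}'(s_1),u_{j_2}'(s_2))$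 where $u$ is the solution on $\tilde\Omega_2$ with $u_{j_1}(s_1)=f_1$, $u_{j_2}(s_2)=f_2$. Then, on each of the three pieces, the problem $(H-\lambda)u=0$, $\gamma u=g$ (with $\gamma$ the trace for the conditions of that piece) has exactly one solution for every $g$, so that $\mathcal M_1,\mathcal M_2$ are well defined; the two-sided map $\mathcal M_1+\mathcal M_2$ is linear; the three Evans functions of the pieces do not vanish at $\lambda$; and $$\frac{E^\Omega_\Gamma(\lambda)}{E^{\Omega_1}_{\Gamma_1}(\lambda)\,E^{\tilde\Omega_1}_{\tilde\Gamma_1}(\lambda)\,E^{\tilde\Omega_2}_{\tilde\Gamma_2}(\lambda)}=\det(\mathcal M_1+\mathcal M_2).$$ -/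

import Mathlib

open MeasureTheory
open scoped Matrix

noncomputable section

/-- A Schrödinger problem on a quantum star graph with `n` edges. Edge `i` is parametrized by the
interval `[left i, right i]`; the left endpoints of all edges are glued to the central vertex and
the right endpoints are the outer vertices. `V i` is the potential on edge `i`; the matrices
`α₁, α₂` give the condition at the central vertex, `β₁, β₂` those at the outer vertices. -/
structure StarGraph (n : ℕ) where
  left : Fin n → ℝ
  right : Fin n → ℝ
  V : Fin n → ℝ → ℂ
  α₁ : Matrix (Fin n) (Fin n) ℂ
  α₂ : Matrix (Fin n) (Fin n) ℂ
  β₁ : Matrix (Fin n) (Fin n) ℂ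
  β₂ : Matrix (Fin n) (Fin n) ℂ

namespace StarGraph

variable {n : ℕ}

/-- The `i`-th edge as a subset of the line. -/
def edge (Ω : StarGraph n) (i : Fin n) : Set ℝ := Set.Icc (Ω.left i) (Ω.right i)

/-- The standing assumptions: nondegenerate edges, integrable potentials, separated self-adjoint
boundary conditions, with diagonal conditions at the outer vertices. -/
structure IsAdmissible (Ω : StarGraph n) : Prop where
  left_lt_right : ∀ i, Ω.left i < Ω.right i
  integrable_V : ∀ i, IntegrableOn (Ω.V i) (Ω.edge i)
  rank_α : (Matrix.fromCols Ω.α₁ Ω.α₂).rank = n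
  rank_β : (Matrix.fromCols Ω.β₁ Ω.β₂).rank = n
  selfAdjoint_α : Ω.α₁ * Ω.α₂ᴴ = Ω.α₂ * Ω.α₁ᴴ
  selfAdjoint_β : Ω.β₁ * Ω.β₂ᴴ = Ω.β₂ * Ω.β₁ᴴ
  diag_β₁ : Ω.β₁.IsDiag
  diag_β₂ : Ω.β₂.IsDiag

/-- The derivative along edge `i`, one-sided at the two ends of the edge. -/
def edgeDeriv (Ω : StarGraph n) (i : Fin n) (u : ℝ → ℂ) (x : ℝ) : ℂ :=
  derivWithin u (Ω.edge i) x

/-- `-u'' + V i * u = w` on edge `i`, with `u` and `u'` absolutely continuous on the closed edge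
(so `u'` is the integral of `u'' = V i * u - w`, an identity that holds almost everywhere). -/
def SolvesOnEdge (Ω : StarGraph n) (i : Fin n) (u w : ℝ → ℂ) : Prop :=
  DifferentiableOn ℝ u (Ω.edge i) ∧
    ∀ x ∈ Ω.edge i, Ω.edgeDeriv i u x =
      Ω.edgeDeriv i u (Ω.left i) + ∫ t in (Ω.left i)..x, (Ω.V i t * u t - w t)

/-- The trace `γ_Γ u`: the outer vertices (index `Sum.inl`) come before the central vertex
(index `Sum.inr`). -/
def trace (Ω : StarGraph n) (u : Fin n → ℝ → ℂ) : Fin n ⊕ Fin n → ℂ :=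
  Sum.elim
    (Ω.β₁ *ᵥ (fun i => u i (Ω.right i)) + Ω.β₂ *ᵥ (fun i => Ω.edgeDeriv i (u i) (Ω.right i)))
    (Ω.α₁ *ᵥ (fun i => u i (Ω.left i)) + Ω.α₂ *ᵥ (fun i => Ω.edgeDeriv i (u i) (Ω.left i)))

/-! ### The operator and its resolvent set -/

/-- The Hilbert space `L²` of the graph. -/
abbrev L2 (Ω : StarGraph n) : Type :=
  PiLp 2 (fun i : Fin n => Lp ℂ 2 (volume.restrict (Ω.edge i)))

/-- The graph of the operator `H_Γ` in `L²`: the pairs `(u, H_Γ u)` with `u` in the domain, that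
is, `u` and `u'` are absolutely continuous, `-u'' + V u` is in `L²` and the trace of `u` vanishes.
(If all `V i` are square integrable, these are the `u` in `H²` with vanishing trace.) -/
def operatorGraph (Ω : StarGraph n) : Set (Ω.L2 × Ω.L2) :=
  {p | ∃ u : Fin n → ℝ → ℂ,
    (∀ i, (p.1 i : ℝ → ℂ) =ᵐ[volume.restrict (Ω.edge i)] u i) ∧
    (∀ i, Ω.SolvesOnEdge i (u i) (p.2 i : ℝ → ℂ)) ∧
    Ω.trace u = 0}

/-- The resolvent set of `H_Γ`: the `lam` for which `H_Γ - lam` is a bijection from the domain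
onto `L²` with a bounded inverse `R`. -/
def resolventSet (Ω : StarGraph n) : Set ℂ :=
  {lam | ∃ R : Ω.L2 →L[ℂ] Ω.L2,
    ∀ u v : Ω.L2, (u, v + lam • u) ∈ Ω.operatorGraph ↔ u = R v}

/-! ### The Evans function -/

/-- The solution of `-u'' + V i * u = lam * u` on edge `i` with `u c = p`, `u' c = q`. -/
def ivpSol (Ω : StarGraph n) (lam : ℂ) (i : Fin n) (c : ℝ) (p q : ℂ) : ℝ → ℂ :=
  Classical.epsilon fun u : ℝ → ℂ =>
    Ω.SolvesOnEdge i u (fun t => lam * u t) ∧ u c = p ∧ Ω.edgeDeriv i u c = q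

/-- Entry `(i, k)` of `Y`: the `i`-th component of the `k`-th solution, with initial data
`-α₂*`, `α₁*` at the central vertex. -/
def solY (Ω : StarGraph n) (lam : ℂ) (i k : Fin n) : ℝ → ℂ :=
  Ω.ivpSol lam i (Ω.left i) (-(Ω.α₂ᴴ i k)) (Ω.α₁ᴴ i k)

/-- Entry `(i, k)` of `Z`: the `i`-th component of the `k`-th solution, with initial data
`-β₂*`, `β₁*` at the outer vertices. -/
def solZ (Ω : StarGraph n) (lam : ℂ) (i k : Fin n) : ℝ → ℂ :=
  Ω.ivpSol lam i (Ω.right i) (-(Ω.β₂ᴴ i k)) (Ω.β₁ᴴ i k)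

/-- The fundamental matrix with blocks `Y, Z` in the first row and `Y', Z'` in the second. -/
def fundamentalMatrix (Ω : StarGraph n) (x : Fin n → ℝ) (lam : ℂ) :
    Matrix (Fin n ⊕ Fin n) (Fin n ⊕ Fin n) ℂ :=
  Matrix.fromBlocks
    (Matrix.of fun i k => Ω.solY lam i k (x i))
    (Matrix.of fun i k => Ω.solZ lam i k (x i))
    (Matrix.of fun i k => Ω.edgeDeriv i (Ω.solY lam i k) (x i))
    (Matrix.of fun i k => Ω.edgeDeriv i (Ω.solZ lam i k) (x i))

/-- The Evans function. By Abel's identity the determinant of the fundamental matrix does not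
depend on the point of evaluation; it is evaluated here at the left end of every edge. -/
def evans (Ω : StarGraph n) (lam : ℂ) : ℂ := (Ω.fundamentalMatrix Ω.left lam).det

/-! ### Cutting the graph -/

/-- The piece of edge `j` beyond the cut at `s`: the interval `[s, right j]`, a star with one edge
with a Dirichlet condition at `s` and the old condition at the outer vertex. -/
def outer (Ω : StarGraph n) (j : Fin n) (s : ℝ) : StarGraph 1 where
  left := fun _ => s
  right := fun _ => Ω.right j
  V := fun _ => Ω.V j
  α₁ := 1
  α₂ := 0
  β₁ := Matrix.of fun _ _ => Ω.β₁ j j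
  β₂ := Matrix.of fun _ _ => Ω.β₂ j j

/-- The piece containing the central vertex: edge `j` ends at `s`, with a Dirichlet condition
there; everything else is unchanged. -/
def inner (Ω : StarGraph n) (j : Fin n) (s : ℝ) : StarGraph n where
  left := Ω.left
  right := Function.update Ω.right j s
  V := Ω.V
  α₁ := Ω.α₁
  α₂ := Ω.α₂
  β₁ := Ω.β₁.updateRow j (Pi.single j 1)
  β₂ := Ω.β₂.updateRow j 0

/-! ### Boundary value problems and Dirichlet-to-Neumann maps -/

/-- `u` solves `(H - lam) u = 0` with `γ_Γ u = g`. -/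
def IsBVPSol (Ω : StarGraph n) (lam : ℂ) (g : Fin n ⊕ Fin n → ℂ) (u : Fin n → ℝ → ℂ) : Prop :=
  (∀ i, Ω.SolvesOnEdge i (u i) (fun t => lam * u i t)) ∧ Ω.trace u = g

/-- For all boundary data the boundary value problem has exactly one solution (as a function on
the graph). -/
def WellPosed (Ω : StarGraph n) (lam : ℂ) : Prop :=
  ∀ g, ∃ u, Ω.IsBVPSol lam g u ∧
    ∀ w, Ω.IsBVPSol lam g w → ∀ i, Set.EqOn (w i) (u i) (Ω.edge i)

/-- The solution of `(H - lam) u = 0`, `γ_Γ u = g`. -/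
def bvpSol (Ω : StarGraph n) (lam : ℂ) (g : Fin n ⊕ Fin n → ℂ) : Fin n → ℝ → ℂ :=
  Classical.epsilon (Ω.IsBVPSol lam g)

/-- `Ω₁`, the piece cut off by the first cut, at `s₁` on edge `j₁`. -/
def piece (Ω : StarGraph n) (j₁ : Fin n) (s₁ : ℝ) : StarGraph 1 := Ω.outer j₁ s₁

/-- `Ω̃₁`, the piece cut off from `Ω₂ = Ω.inner j₁ s₁` by the second cut, at `s₂` on edge `j₂`. -/
def tpiece₁ (Ω : StarGraph n) (j₁ : Fin n) (s₁ : ℝ) (j₂ : Fin n) (s₂ : ℝ) : StarGraph 1 :=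
  (Ω.inner j₁ s₁).outer j₂ s₂

/-- `Ω̃₂`, the piece that contains the central vertex after both cuts. -/
def tpiece₂ (Ω : StarGraph n) (j₁ : Fin n) (s₁ : ℝ) (j₂ : Fin n) (s₂ : ℝ) : StarGraph n :=
  (Ω.inner j₁ s₁).inner j₂ s₂

/-- The map `𝓜₁` for two cuts on one wire: `f ↦ (u'(s₁), -u'(s₂))`, where `u` solves the equation
on `Ω̃₁ = [s₂, s₁]` with `u(s₁) = f₁`, `u(s₂) = f₂`. -/
def oneWireMap₁ (Ω : StarGraph n) (j : Fin n) (s₁ s₂ : ℝ) (lam : ℂ) (f : Fin 2 → ℂ) :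
    Fin 2 → ℂ :=
  let A := Ω.tpiece₁ j s₁ j s₂
  let u := A.bvpSol lam (Sum.elim (fun _ => f 0) (fun _ => f 1))
  ![A.edgeDeriv 0 (u 0) s₁, -A.edgeDeriv 0 (u 0) s₂]

/-- The map `𝓜₂` for two cuts on one wire: `f ↦ (-u'(s₁), w_j'(s₂))`, where `u` solves the equation
on `Ω₁` with `u(s₁) = f₁`, `w` solves it on `Ω̃₂` with `w_j(s₂) = f₂`, and `u`, `w` satisfy all
other conditions. -/
def oneWireMap₂ (Ω : StarGraph n) (j : Fin n) (s₁ s₂ : ℝ) (lam : ℂ) (f : Fin 2 → ℂ) :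
    Fin 2 → ℂ :=
  let A := Ω.piece j s₁
  let B := Ω.tpiece₂ j s₁ j s₂
  let u := A.bvpSol lam (Sum.elim 0 (fun _ => f 0))
  let w := B.bvpSol lam (Sum.elim (Pi.single j (f 1)) 0)
  ![-A.edgeDeriv 0 (u 0) s₁, B.edgeDeriv j (w j) s₂]

/-- The map `𝓜₁` for cuts on two wires: `f ↦ (-u'(s₁), -w'(s₂))`, where `u` solves the equation on
`Ω₁` with `u(s₁) = f₁`, `w` solves it on `Ω̃₁` with `w(s₂) = f₂`, and both satisfy the other
condition. -/
def twoWireMap₁ (Ω : StarGraph n) (j₁ : Fin n) (s₁ : ℝ) (j₂ : Fin n) (s₂ : ℝ) (lam : ℂ)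
    (f : Fin 2 → ℂ) : Fin 2 → ℂ :=
  let A := Ω.piece j₁ s₁
  let B := Ω.tpiece₁ j₁ s₁ j₂ s₂
  let u := A.bvpSol lam (Sum.elim 0 (fun _ => f 0))
  let w := B.bvpSol lam (Sum.elim 0 (fun _ => f 1))
  ![-A.edgeDeriv 0 (u 0) s₁, -B.edgeDeriv 0 (w 0) s₂]

/-- The map `𝓜₂` for cuts on two wires: `f ↦ (u_{j₁}'(s₁), u_{j₂}'(s₂))`, where `u` solves the
equation on `Ω̃₂` with `u_{j₁}(s₁) = f₁`, `u_{j₂}(s₂) = f₂` and all other conditions. -/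
def twoWireMap₂ (Ω : StarGraph n) (j₁ : Fin n) (s₁ : ℝ) (j₂ : Fin n) (s₂ : ℝ) (lam : ℂ)
    (f : Fin 2 → ℂ) : Fin 2 → ℂ :=
  let A := Ω.tpiece₂ j₁ s₁ j₂ s₂
  let u := A.bvpSol lam (Sum.elim (Pi.single j₁ (f 0) + Pi.single j₂ (f 1)) 0)
  ![A.edgeDeriv j₁ (u j₁) s₁, A.edgeDeriv j₂ (u j₂) s₂]

/-- The two-sided map `𝓜₁ + 𝓜₂` associated with the cuts `s₁` on edge `j₁` and `s₂` on
edge `j₂`. -/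
def twoSidedMap (Ω : StarGraph n) (j₁ : Fin n) (s₁ : ℝ) (j₂ : Fin n) (s₂ : ℝ) (lam : ℂ)
    (f : Fin 2 → ℂ) : Fin 2 → ℂ :=
  if j₁ = j₂ then
    Ω.oneWireMap₁ j₁ s₁ s₂ lam f + Ω.oneWireMap₂ j₁ s₁ s₂ lam f
  else
    Ω.twoWireMap₁ j₁ s₁ j₂ s₂ lam f + Ω.twoWireMap₂ j₁ s₁ j₂ s₂ lam f

end StarGraph

end

/-! Let `z i` be the solution on edge `i` with data `(-β₂*, β₁*)` at its outer vertex. Evaluated at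
the left ends, the Evans function is the determinant of a matrix whose columns are `(-α₂ᴴ, α₁ᴴ)` and
the diagonal blocks of `z`, `z'` (`evans_eq_det_dataMatrix`). For a piece cut off at `s` the first
column is `(0, 1)`, so its Evans function is `-z s` (`evans_outer`), and its one-sided map is
multiplication by `-z' s / z s`.

Shortening edges of the star changes only the columns of the cut edges. Write `z j = z j (s) • ψ +
z' j (s) • y`, where `ψ` has data `(1, 0)` and `y` has data `(0, 1)` at the cut. Here `y` already
supplies a column of the matrix of the shortened star, and expanding the central data of `ψ` in the
columns of that matrix produces, up to sign, the Dirichlet-to-Neumann matrix `N`. Hence the quotient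
of the two Evans functions is `det (diag z' - N * diag z)` over the cut edges
(`exists_dirichletToNeumann`).

For two wires, dividing by `z j₁ s₁ * z j₂ s₂` turns this into the determinant of `N - diag (z' /
z)`, the two-sided map. For one wire the inner star sees only the cut at `s₂`; the interval `[s₂,
s₁]` is treated with a fundamental system of Wronskian 1.

Unique solvability is a finite-dimensional alternative: the trace acts on initial data as a square
linear map, and it is injective because a point of the resolvent set is not an eigenvalue. The
potentials are only integrable, so the initial value problem and Abel's identity are obtained from
Volterra iteration and absolute continuity. -/

noncomputable section

/-! ### Linear second order equations with integrable coefficients -/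

namespace SturmLiouville

open Set Filter Topology

/-! ### Primitives of integrable functions. -/

section Primitive

variable {E : Type*} [NormedAddCommGroup E] [NormedSpace ℝ E] {f g : ℝ → E} {a b : ℝ}

/-- Increments of `f` are dominated by those of the primitive of `‖g‖`, which is absolutely
continuous. -/
lemma absolutelyContinuousOnInterval_of_eq_integral (hab : a ≤ b)
    (hg : IntervalIntegrable g volume a b)
    (hf : ∀ x ∈ Icc a b, f x = f a + ∫ t in a..x, g t) :
    AbsolutelyContinuousOnInterval f a b := by
  have hΦ := hg.norm.absolutelyContinuousOnInterval_intervalIntegral (c := a) (by simp)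
  refine squeeze_zero' (Eventually.of_forall fun _ => Finset.sum_nonneg fun _ _ => dist_nonneg)
    ?_ hΦ
  rw [eventually_inf_principal]
  filter_upwards with ⟨n, I⟩ hI
  refine Finset.sum_le_sum fun i hi => ?_
  obtain ⟨h₁, h₂⟩ := hI.1 i hi
  have key : ∀ x ∈ uIcc a b, IntervalIntegrable g volume a x := fun x hx =>
    hg.mono_set (uIcc_subset_uIcc_left hx)
  rw [dist_comm, dist_comm (∫ v in a.._, ‖g v‖), dist_eq_norm, dist_eq_norm,
    intervalIntegral.integral_interval_sub_left (key _ h₂).norm (key _ h₁).norm]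
  rw [uIcc_of_le hab] at h₁ h₂
  rw [hf _ h₁, hf _ h₂, add_sub_add_left_eq_sub, intervalIntegral.integral_interval_sub_left
    (key _ (by rwa [uIcc_of_le hab])) (key _ (by rwa [uIcc_of_le hab]))]
  exact intervalIntegral.norm_integral_le_abs_integral_norm

lemma ae_hasDerivAt_of_eq_integral [CompleteSpace E] (hab : a ≤ b)
    (hg : IntervalIntegrable g volume a b)
    (hf : ∀ x ∈ Icc a b, f x = f a + ∫ t in a..x, g t) :
    ∀ᵐ x, x ∈ uIcc a b → HasDerivAt f (g x) x := by
  have h₁ : ∀ᵐ x : ℝ, x ≠ a := by simp [ae_iff, measure_singleton]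
  have h₂ : ∀ᵐ x : ℝ, x ≠ b := by simp [ae_iff, measure_singleton]
  filter_upwards [hg.ae_hasDerivAt_integral, h₁, h₂] with x hx hxa hxb hxm
  have hd := (hx hxm a (by simp)).const_add (f a)
  rw [uIcc_of_le hab] at hxm
  refine hd.congr_of_eventuallyEq ?_
  filter_upwards [Icc_mem_nhds (lt_of_le_of_ne hxm.1 hxa.symm) (lt_of_le_of_ne hxm.2 hxb)]
    with y hy using hf y hy

end Primitive

/-- This is the source of the factorial in the Volterra estimate. As `k` is only integrable, the
chain rule holds almost everywhere, and the difference of the two sides is constant because it is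
absolutely continuous with derivative zero almost everywhere. -/
lemma integral_mul_primitive_pow {k : ℝ → ℝ} (hk : Integrable k) {a x : ℝ} (hax : a ≤ x) (m : ℕ) :
    ∫ t in a..x, k t * (∫ s in a..t, k s) ^ m = (∫ s in a..x, k s) ^ (m + 1) / (m + 1) := by
  set φ : ℝ → ℝ := fun t => ∫ s in a..t, k s with hφ
  have hφc : Continuous φ := intervalIntegral.continuous_primitive
    (fun _ _ => hk.intervalIntegrable) a
  have hki : IntervalIntegrable (fun t => k t * φ t ^ m) volume a x :=
    hk.intervalIntegrable.mul_continuousOn (hφc.pow m).continuousOn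
  have hφac : AbsolutelyContinuousOnInterval φ a x :=
    absolutelyContinuousOnInterval_of_eq_integral (g := k) hax hk.intervalIntegrable
      (by simp [hφ])
  have hpow : ∀ j : ℕ, AbsolutelyContinuousOnInterval (fun t => φ t ^ (j + 1)) a x := by
    intro j
    induction j with
    | zero => simpa using hφac
    | succ j ih => simpa [pow_succ _ (j + 1)] using ih.fun_mul hφac
  set ψ : ℝ → ℝ := fun t => ∫ s in a..t, k s * φ s ^ m with hψ
  have hψac : AbsolutelyContinuousOnInterval ψ a x :=
    absolutelyContinuousOnInterval_of_eq_integral (g := fun t => k t * φ t ^ m) hax hki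
      (by simp [hψ])
  obtain ⟨C, hC⟩ := ((hpow m).fun_sub
      (hψac.const_mul ((m : ℝ) + 1))).const_of_ae_hasDerivAt_zero (by
    filter_upwards [ae_hasDerivAt_of_eq_integral (f := φ) hax hk.intervalIntegrable
        (by simp [hφ]),
      ae_hasDerivAt_of_eq_integral (f := ψ) hax hki (by simp [hψ])] with t h₁ h₂ ht
    refine (((h₁ ht).pow (m + 1)).sub ((h₂ ht).const_mul ((m : ℝ) + 1))).congr_deriv ?_
    push_cast
    ring)
  have h0 := hC a (by simp)
  have h1 := hC x (by simp)
  rw [show φ a = 0 by simp [hφ], show ψ a = 0 by simp [hψ], zero_pow (Nat.succ_ne_zero m)] at h0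
  have hm : (m : ℝ) + 1 ≠ 0 := by positivity
  rw [eq_div_iff hm]
  change ψ x * _ = φ x ^ (m + 1)
  linarith

/-- `u'' = q * u` on `[a, b]` with `u' = v`, where `v` is absolutely continuous. -/
structure IsSol (q : ℝ → ℂ) (a b : ℝ) (u v : ℝ → ℂ) : Prop where
  hasDeriv : ∀ x ∈ Icc a b, HasDerivWithinAt u (v x) (Icc a b) x
  eq_integral : ∀ x ∈ Icc a b, v x = v a + ∫ t in a..x, q t * u t

/-! ### Picard iteration for the Volterra operator. -/

section Volterra

variable {q : ℝ → ℂ} {a b : ℝ}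

/-- The Volterra operator whose fixed points solve `u'' = q * u`, `u a = p`, `u' a = r`. -/
def volterra (q : ℝ → ℂ) (hq : Integrable q) (hab : a ≤ b) (p r : ℂ) (u : C(Icc a b, ℂ)) :
    C(Icc a b, ℂ) where
  toFun x := p + ∫ s in a..x, (r + ∫ t in a..s, q t * IccExtend hab u t)
  continuous_toFun := by
    have h₁ : ∀ c d, IntervalIntegrable (fun t => q t * IccExtend hab u t) volume c d :=
      fun c d => hq.intervalIntegrable.mul_continuousOn (u.continuous.Icc_extend' ).continuousOn
    have h₂ : Continuous fun s => r + ∫ t in a..s, q t * IccExtend hab u t :=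
      continuous_const.add (intervalIntegral.continuous_primitive h₁ a)
    exact (continuous_const.add (intervalIntegral.continuous_primitive
      (fun c d => h₂.intervalIntegrable c d) a)).comp continuous_subtype_val

variable (hq : Integrable q) (hab : a ≤ b)

lemma intervalIntegrable_mul_IccExtend (hq : Integrable q) (u : C(Icc a b, ℂ)) (c d : ℝ) :
    IntervalIntegrable (fun t => q t * IccExtend hab u t) volume c d :=
  hq.intervalIntegrable.mul_continuousOn (u.continuous.Icc_extend').continuousOn

/-- The inner integral is bounded by its value with upper limit `x`; the outer one then contributes
the length `x - a ≤ b - a`. -/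
lemma norm_volterra_sub_le (p r : ℂ) (u w : C(Icc a b, ℂ)) (x : Icc a b) :
    ‖volterra q hq hab p r u x - volterra q hq hab p r w x‖ ≤
      ∫ t in a..x, (b - a) * ‖q t‖ * ‖IccExtend hab u t - IccExtend hab w t‖ := by
  have hx := x.2
  have hu := intervalIntegrable_mul_IccExtend hab hq u
  have hw := intervalIntegrable_mul_IccExtend hab hq w
  have hc : ∀ z : C(Icc a b, ℂ), Continuous fun s => r + ∫ t in a..s, q t * IccExtend hab z t :=
    fun z => continuous_const.add (intervalIntegral.continuous_primitive
      (intervalIntegrable_mul_IccExtend hab hq z) a)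
  have hk : ∀ c d, IntervalIntegrable
      (fun t => ‖q t‖ * ‖IccExtend hab u t - IccExtend hab w t‖) volume c d := fun c d =>
    hq.norm.intervalIntegrable.mul_continuousOn
      (u.continuous.Icc_extend'.sub w.continuous.Icc_extend').norm.continuousOn
  have hmono : ∀ s ∈ Icc a (x : ℝ), ‖(r + ∫ t in a..s, q t * IccExtend hab u t) -
      (r + ∫ t in a..s, q t * IccExtend hab w t)‖ ≤
      ∫ t in a..x, ‖q t‖ * ‖IccExtend hab u t - IccExtend hab w t‖ := by
    intro s hs
    rw [add_sub_add_left_eq_sub, ← intervalIntegral.integral_sub (hu _ _) (hw _ _)]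
    refine (intervalIntegral.norm_integral_le_integral_norm hs.1).trans ?_
    simp only [← mul_sub, norm_mul]
    exact intervalIntegral.integral_mono_interval le_rfl hs.1 hs.2
      (Eventually.of_forall fun t => by positivity) (hk _ _)
  change ‖(p + ∫ s in a..x, _) - (p + ∫ s in a..x, _)‖ ≤ _
  rw [add_sub_add_left_eq_sub, ← intervalIntegral.integral_sub
    ((hc u).intervalIntegrable _ _) ((hc w).intervalIntegrable _ _)]
  refine (intervalIntegral.norm_integral_le_of_norm_le_const fun s hs => hmono s ?_).trans ?_
  · rw [uIoc_of_le hx.1] at hs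
    exact ⟨hs.1.le, hs.2⟩
  · simp only [mul_assoc]
    rw [intervalIntegral.integral_const_mul, mul_comm, abs_of_nonneg (sub_nonneg.2 hx.1)]
    refine mul_le_mul_of_nonneg_right (by linarith [hx.2]) ?_
    exact intervalIntegral.integral_nonneg hx.1 fun t _ => by positivity

lemma norm_volterra_iterate_sub_le (p r : ℂ) (u w : C(Icc a b, ℂ)) (m : ℕ) (x : Icc a b) :
    ‖(volterra q hq hab p r)^[m] u x - (volterra q hq hab p r)^[m] w x‖ ≤
      (∫ t in a..x, (b - a) * ‖q t‖) ^ m / m.factorial * dist u w := by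
  induction m generalizing x with
  | zero => simpa [dist_eq_norm] using (u - w).norm_coe_le_norm x
  | succ m ih =>
    have hx := x.2
    have hk : Integrable fun t => (b - a) * ‖q t‖ := hq.norm.const_mul _
    have hφc : Continuous fun t => ∫ s in a..t, (b - a) * ‖q s‖ :=
      intervalIntegral.continuous_primitive (fun _ _ => hk.intervalIntegrable) a
    rw [Function.iterate_succ_apply', Function.iterate_succ_apply']
    refine (norm_volterra_sub_le hq hab p r _ _ x).trans ?_
    have hle : ∫ t in a..x, (b - a) * ‖q t‖ * ‖IccExtend hab ((volterra q hq hab p r)^[m] u) t -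
          IccExtend hab ((volterra q hq hab p r)^[m] w) t‖ ≤
        ∫ t in a..x, (b - a) * ‖q t‖ * (∫ s in a..t, (b - a) * ‖q s‖) ^ m *
          (dist u w / m.factorial) := by
      refine intervalIntegral.integral_mono_on hx.1 ?_ ?_ fun t ht => ?_
      · exact hk.intervalIntegrable.mul_continuousOn (((ContinuousMap.continuous _).Icc_extend'.sub
          (ContinuousMap.continuous _).Icc_extend').norm.continuousOn)
      · exact (hk.intervalIntegrable.mul_continuousOn (hφc.pow m).continuousOn).mul_const _
      · have ht' : t ∈ Icc a b := ⟨ht.1, ht.2.trans hx.2⟩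
        rw [IccExtend_of_mem hab _ ht', IccExtend_of_mem hab _ ht',
          mul_assoc ((b - a) * ‖q t‖)]
        have hba : 0 ≤ b - a := sub_nonneg.2 hab
        refine mul_le_mul_of_nonneg_left ((ih ⟨t, ht'⟩).trans (le_of_eq ?_))
          (mul_nonneg hba (norm_nonneg (q t)))
        ring
    refine hle.trans (le_of_eq ?_)
    rw [intervalIntegral.integral_mul_const, integral_mul_primitive_pow hk hx.1 m,
      Nat.factorial_succ]
    push_cast
    field_simp

/-- The operator itself need not contract, but the Lipschitz constants `L ^ m / m!` of its iterates
tend to zero. -/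
lemma exists_contractingWith_volterra_iterate (p r : ℂ) :
    ∃ (m : ℕ) (K : NNReal), ContractingWith K (volterra q hq hab p r)^[m] := by
  set L := ∫ t in a..b, (b - a) * ‖q t‖ with hL
  have hk : Integrable fun t => (b - a) * ‖q t‖ := hq.norm.const_mul _
  have hba : 0 ≤ b - a := sub_nonneg.2 hab
  obtain ⟨m, hm⟩ := ((FloorSemiring.tendsto_pow_div_factorial_atTop L).eventually_lt_const
    zero_lt_one).exists
  have hL0 : 0 ≤ L := intervalIntegral.integral_nonneg hab fun t _ =>
    mul_nonneg hba (norm_nonneg _)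
  have hK : 0 ≤ L ^ m / m.factorial := div_nonneg (pow_nonneg hL0 m) (Nat.cast_nonneg _)
  refine ⟨m, ⟨_, hK⟩, hm, LipschitzWith.of_dist_le_mul fun u w => ?_⟩
  refine (ContinuousMap.dist_le (mul_nonneg hK dist_nonneg)).2 fun x => ?_
  rw [dist_eq_norm]
  refine (norm_volterra_iterate_sub_le hq hab p r u w m x).trans ?_
  change _ ≤ L ^ m / m.factorial * dist u w
  have h0 : 0 ≤ ∫ t in a..x, (b - a) * ‖q t‖ :=
    intervalIntegral.integral_nonneg x.2.1 fun t _ => mul_nonneg hba (norm_nonneg _)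
  have hle : ∫ t in a..x, (b - a) * ‖q t‖ ≤ L :=
    intervalIntegral.integral_mono_interval le_rfl x.2.1 x.2.2
      (Eventually.of_forall fun t => mul_nonneg hba (norm_nonneg _)) hk.intervalIntegrable
  gcongr

end Volterra

/-! ### Initial value problems and the Wronskian. -/

section Solutions

variable {q : ℝ → ℂ} {a b : ℝ} {u v u₁ v₁ u₂ v₂ : ℝ → ℂ}

lemma intervalIntegrable_mul_of_continuousOn (hq : IntegrableOn q (Icc a b))
    (hu : ContinuousOn u (Icc a b)) {c d : ℝ} (hc : c ∈ Icc a b) (hd : d ∈ Icc a b) :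
    IntervalIntegrable (fun t => q t * u t) volume c d := by
  rw [intervalIntegrable_iff]
  exact (hq.mul_continuousOn hu isCompact_Icc).mono_set
    (uIoc_subset_uIcc.trans (ordConnected_Icc.uIcc_subset hc hd))

namespace IsSol

lemma continuousOn_fst (h : IsSol q a b u v) : ContinuousOn u (Icc a b) :=
  fun x hx => (h.hasDeriv x hx).continuousWithinAt

lemma continuousOn_snd (h : IsSol q a b u v) (hab : a < b) (hq : IntegrableOn q (Icc a b)) :
    ContinuousOn v (Icc a b) := by
  have hi := (intervalIntegrable_mul_of_continuousOn hq h.continuousOn_fst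
    (left_mem_Icc.2 hab.le) (right_mem_Icc.2 hab.le))
  have := absolutelyContinuousOnInterval_of_eq_integral hab.le hi h.eq_integral
  simpa [uIcc_of_le hab.le] using this.continuousOn

lemma fst_eq_integral (h : IsSol q a b u v) (hab : a < b) (hq : IntegrableOn q (Icc a b)) :
    ∀ x ∈ Icc a b, u x = u a + ∫ t in a..x, v t := by
  intro x hx
  have hsub : Icc a x ⊆ Icc a b := Icc_subset_Icc_right hx.2
  rw [intervalIntegral.integral_eq_sub_of_hasDerivAt_of_le hx.1 (h.continuousOn_fst.mono hsub)
    (fun y hy => (h.hasDeriv y (hsub (Ioo_subset_Icc_self hy))).hasDerivAt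
      (Icc_mem_nhds hy.1 (hy.2.trans_le hx.2)))
    (((h.continuousOn_snd hab hq).mono hsub).intervalIntegrable_of_Icc hx.1)]
  ring

lemma add (h₁ : IsSol q a b u₁ v₁) (h₂ : IsSol q a b u₂ v₂) (hq : IntegrableOn q (Icc a b)) :
    IsSol q a b (fun x => u₁ x + u₂ x) (fun x => v₁ x + v₂ x) where
  hasDeriv x hx := (h₁.hasDeriv x hx).add (h₂.hasDeriv x hx)
  eq_integral x hx := by
    have ha : a ∈ Icc a b := left_mem_Icc.2 (hx.1.trans hx.2)
    simp only [mul_add]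
    rw [intervalIntegral.integral_add
      (intervalIntegrable_mul_of_continuousOn hq h₁.continuousOn_fst ha hx)
      (intervalIntegrable_mul_of_continuousOn hq h₂.continuousOn_fst ha hx),
      h₁.eq_integral x hx, h₂.eq_integral x hx]
    ring

lemma const_mul (h : IsSol q a b u v) (c : ℂ) :
    IsSol q a b (fun x => c * u x) (fun x => c * v x) where
  hasDeriv x hx := (h.hasDeriv x hx).const_mul c
  eq_integral x hx := by
    simp only [mul_left_comm _ c]
    rw [intervalIntegral.integral_const_mul, h.eq_integral x hx]
    ring

lemma linComb (h₁ : IsSol q a b u₁ v₁) (h₂ : IsSol q a b u₂ v₂)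
    (hq : IntegrableOn q (Icc a b)) (c d : ℂ) :
    IsSol q a b (fun x => c * u₁ x + d * u₂ x) (fun x => c * v₁ x + d * v₂ x) :=
  (h₁.const_mul c).add (h₂.const_mul d) hq

lemma mono (h : IsSol q a b u v) (hq : IntegrableOn q (Icc a b)) {c d : ℝ} (hac : a ≤ c)
    (hdb : d ≤ b) : IsSol q c d u v where
  hasDeriv x hx := (h.hasDeriv x (Icc_subset_Icc hac hdb hx)).mono (Icc_subset_Icc hac hdb)
  eq_integral x hx := by
    have hx' := Icc_subset_Icc hac hdb hx
    have hc : c ∈ Icc a b := ⟨hac, hx.1.trans hx'.2⟩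
    have ha : a ∈ Icc a b := left_mem_Icc.2 (hx'.1.trans hx'.2)
    rw [h.eq_integral x hx', h.eq_integral c hc, add_assoc,
      intervalIntegral.integral_add_adjacent_intervals
        (intervalIntegrable_mul_of_continuousOn hq h.continuousOn_fst ha hc)
        (intervalIntegrable_mul_of_continuousOn hq h.continuousOn_fst hc hx')]

lemma congr_coeff {q' : ℝ → ℂ} (h : IsSol q a b u v) (hqq : ∀ x ∈ Icc a b, q x = q' x) :
    IsSol q' a b u v where
  hasDeriv := h.hasDeriv
  eq_integral x hx := by
    rw [h.eq_integral x hx]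
    congr 1
    refine intervalIntegral.integral_congr fun t ht => ?_
    rw [uIcc_of_le hx.1] at ht
    simp only [hqq t ⟨ht.1, ht.2.trans hx.2⟩]

/-- **Abel's identity**: the Wronskian of two solutions is constant. -/
lemma wronskian_eq (h₁ : IsSol q a b u₁ v₁) (h₂ : IsSol q a b u₂ v₂) (hab : a < b)
    (hq : IntegrableOn q (Icc a b)) {x y : ℝ} (hx : x ∈ Icc a b) (hy : y ∈ Icc a b) :
    u₁ x * v₂ x - v₁ x * u₂ x = u₁ y * v₂ y - v₁ y * u₂ y := by
  have ha : a ∈ Icc a b := left_mem_Icc.2 hab.le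
  have hb : b ∈ Icc a b := right_mem_Icc.2 hab.le
  have iu₁ := intervalIntegrable_mul_of_continuousOn hq h₁.continuousOn_fst ha hb
  have iu₂ := intervalIntegrable_mul_of_continuousOn hq h₂.continuousOn_fst ha hb
  have iv₁ := (h₁.continuousOn_snd hab hq).intervalIntegrable_of_Icc (μ := volume) hab.le
  have iv₂ := (h₂.continuousOn_snd hab hq).intervalIntegrable_of_Icc (μ := volume) hab.le
  have eu₁ := h₁.fst_eq_integral hab hq
  have eu₂ := h₂.fst_eq_integral hab hq
  have au₁ := absolutelyContinuousOnInterval_of_eq_integral hab.le iv₁ eu₁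
  have au₂ := absolutelyContinuousOnInterval_of_eq_integral hab.le iv₂ eu₂
  have av₁ := absolutelyContinuousOnInterval_of_eq_integral hab.le iu₁ h₁.eq_integral
  have av₂ := absolutelyContinuousOnInterval_of_eq_integral hab.le iu₂ h₂.eq_integral
  -- Almost everywhere the derivative is `v₁ v₂ + u₁ q u₂ - q u₁ u₂ - v₁ v₂ = 0`.
  obtain ⟨C, hC⟩ := ((au₁.smul av₂).sub (av₁.smul au₂)).const_of_ae_hasDerivAt_zero (by
    filter_upwards [ae_hasDerivAt_of_eq_integral hab.le iv₁ eu₁,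
      ae_hasDerivAt_of_eq_integral hab.le iv₂ eu₂,
      ae_hasDerivAt_of_eq_integral hab.le iu₁ h₁.eq_integral,
      ae_hasDerivAt_of_eq_integral hab.le iu₂ h₂.eq_integral] with t d₁ d₂ e₁ e₂ ht
    refine (((d₁ ht).mul (e₂ ht)).sub ((e₁ ht).mul (d₂ ht))).congr_deriv ?_
    ring)
  rw [uIcc_of_le hab.le] at hC
  simpa using (hC x hx).trans (hC y hy).symm

/-- Both `u` and `0` are fixed points of the Volterra operator with zero data, one of whose iterates
is a contraction. Replacing `q` by its indicator makes it integrable on the whole line, as that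
operator requires. -/
lemma eq_zero_of_left (h : IsSol q a b u v) (hab : a < b) (hq : IntegrableOn q (Icc a b))
    (hu : u a = 0) (hv : v a = 0) : ∀ x ∈ Icc a b, u x = 0 ∧ v x = 0 := by
  have hqi : Integrable ((Icc a b).indicator q) := hq.integrable_indicator measurableSet_Icc
  have h' : IsSol ((Icc a b).indicator q) a b u v :=
    h.congr_coeff fun x hx => (indicator_of_mem hx q).symm
  let U : C(Icc a b, ℂ) := ⟨(Icc a b).domRestrict u, h.continuousOn_fst.domRestrict⟩
  obtain ⟨m, K, hK⟩ := exists_contractingWith_volterra_iterate hqi hab.le 0 0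
  have hU : Function.IsFixedPt (volterra _ hqi hab.le 0 0) U := by
    ext x
    change (0 : ℂ) + ∫ s in a..x, (0 + ∫ t in a..s, _ * IccExtend hab.le U t) = u x
    rw [h.fst_eq_integral hab hq x x.2, hu]
    congr 1
    refine intervalIntegral.integral_congr fun s hs => ?_
    rw [uIcc_of_le x.2.1] at hs
    have hs' : s ∈ Icc a b := ⟨hs.1, hs.2.trans x.2.2⟩
    rw [h'.eq_integral s hs', hv]
    congr 1
    refine intervalIntegral.integral_congr fun t ht => ?_
    rw [uIcc_of_le hs'.1] at ht
    rw [IccExtend_of_mem hab.le _ ⟨ht.1, ht.2.trans hs'.2⟩]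
    rfl
  have h0 : Function.IsFixedPt (volterra _ hqi hab.le 0 0) (0 : C(Icc a b, ℂ)) := by
    ext x
    change (0 : ℂ) + ∫ s in a..x, (0 + ∫ t in a..s, _ * (0 : ℂ)) = 0
    simp
  have hU0 : U = 0 := hK.fixedPoint_unique' (hU.iterate m) (h0.iterate m)
  have hu0 : ∀ x ∈ Icc a b, u x = 0 := fun x hx => DFunLike.congr_fun hU0 ⟨x, hx⟩
  refine fun x hx => ⟨hu0 x hx, ?_⟩
  rw [h.eq_integral x hx, hv, zero_add]
  refine intervalIntegral.integral_zero_ae (Eventually.of_forall fun t ht => ?_)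
  rw [uIoc_of_le hx.1] at ht
  rw [hu0 t ⟨ht.1.le, ht.2.trans hx.2⟩, mul_zero]

end IsSol

lemma exists_isSol_left (hab : a < b) (hq : IntegrableOn q (Icc a b)) (p r : ℂ) :
    ∃ u v, IsSol q a b u v ∧ u a = p ∧ v a = r := by
  have hqi : Integrable ((Icc a b).indicator q) := hq.integrable_indicator measurableSet_Icc
  obtain ⟨m, K, hK⟩ := exists_contractingWith_volterra_iterate hqi hab.le p r
  have hfix := hK.isFixedPt_fixedPoint_iterate
  set U := ContractingWith.fixedPoint _ hK
  set v : ℝ → ℂ := fun s => r + ∫ t in a..s, (Icc a b).indicator q t * IccExtend hab.le U t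
    with hv
  have hvc : Continuous v := continuous_const.add (intervalIntegral.continuous_primitive
    (intervalIntegrable_mul_IccExtend hab.le hqi U) a)
  have hu : ∀ x ∈ Icc a b, IccExtend hab.le U x = p + ∫ s in a..x, v s := by
    intro x hx
    rw [IccExtend_of_mem hab.le _ hx]
    exact (DFunLike.congr_fun hfix ⟨x, hx⟩).symm
  have hsol : IsSol ((Icc a b).indicator q) a b (IccExtend hab.le U) v := by
    refine ⟨fun x hx => ?_, fun x hx => by simp [hv]⟩
    have hd : HasDerivAt (fun x => p + ∫ s in a..x, v s) (v x) x :=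
      (intervalIntegral.integral_hasDerivAt_right (hvc.intervalIntegrable _ _)
        (hvc.stronglyMeasurableAtFilter _ _) hvc.continuousAt).const_add p
    exact hd.hasDerivWithinAt.congr hu (hu x hx)
  refine ⟨_, v, hsol.congr_coeff fun x hx => indicator_of_mem hx q, ?_, by simp [hv]⟩
  rw [hu a (left_mem_Icc.2 hab.le)]
  simp

/-- The initial value problem at an arbitrary point of the interval is solvable. -/
lemma exists_isSol (hab : a < b) (hq : IntegrableOn q (Icc a b)) {c : ℝ} (hc : c ∈ Icc a b)
    (p r : ℂ) : ∃ u v, IsSol q a b u v ∧ u c = p ∧ v c = r := by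
  obtain ⟨u₁, v₁, h₁, hu₁, hv₁⟩ := exists_isSol_left hab hq 1 0
  obtain ⟨u₂, v₂, h₂, hu₂, hv₂⟩ := exists_isSol_left hab hq 0 1
  have hW := h₁.wronskian_eq h₂ hab hq hc (left_mem_Icc.2 hab.le)
  rw [hu₁, hv₁, hu₂, hv₂] at hW
  -- Cramer's rule at `c`; the determinant is the Wronskian, equal to 1.
  refine ⟨_, _, h₁.linComb h₂ hq (p * v₂ c - r * u₂ c) (r * u₁ c - p * v₁ c), ?_, ?_⟩
  · linear_combination p * hW
  · linear_combination r * hW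

lemma IsSol.eq_zero (h : IsSol q a b u v) (hab : a < b) (hq : IntegrableOn q (Icc a b))
    {c : ℝ} (hc : c ∈ Icc a b) (hu : u c = 0) (hv : v c = 0) :
    ∀ x ∈ Icc a b, u x = 0 ∧ v x = 0 := by
  have ha : a ∈ Icc a b := left_mem_Icc.2 hab.le
  obtain ⟨u₁, v₁, h₁, hu₁, hv₁⟩ := exists_isSol_left hab hq 1 0
  obtain ⟨u₂, v₂, h₂, hu₂, hv₂⟩ := exists_isSol_left hab hq 0 1
  -- The Wronskians with the two basis solutions vanish at `c`; at `a` they are, up to sign, `v a`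
  -- and `u a`.
  have W₁ := h.wronskian_eq h₁ hab hq hc ha
  have W₂ := h.wronskian_eq h₂ hab hq hc ha
  simp only [hu, hv, hu₁, hv₁, hu₂, hv₂] at W₁ W₂
  exact h.eq_zero_of_left hab hq (by linear_combination -W₂) (by linear_combination W₁)

/-- Solutions of the initial value problem are unique. -/
lemma IsSol.eq_of_eq (h₁ : IsSol q a b u₁ v₁) (h₂ : IsSol q a b u₂ v₂) (hab : a < b)
    (hq : IntegrableOn q (Icc a b)) {c : ℝ} (hc : c ∈ Icc a b) (hu : u₁ c = u₂ c)
    (hv : v₁ c = v₂ c) {x : ℝ} (hx : x ∈ Icc a b) : u₁ x = u₂ x ∧ v₁ x = v₂ x := by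
  obtain ⟨h, h'⟩ := (h₁.linComb h₂ hq 1 (-1)).eq_zero hab hq hc (by rw [hu]; ring)
    (by rw [hv]; ring) x hx
  exact ⟨by linear_combination h, by linear_combination h'⟩

end Solutions

end SturmLiouville

/-! ### Admissibility in coordinates and its inheritance by the pieces. -/

namespace StarGraph

open Set Filter Topology SturmLiouville

variable {n : ℕ}

/-- Admissibility in coordinates: a form of `IsAdmissible` that is visibly inherited by the pieces
of a graph. -/
structure IsRegular (Ω : StarGraph n) : Prop where
  left_lt_right : ∀ i, Ω.left i < Ω.right i
  integrable_V : ∀ i, IntegrableOn (Ω.V i) (Ω.edge i)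
  eq_zero_of_α : ∀ c, Ω.α₁ᴴ *ᵥ c = 0 → Ω.α₂ᴴ *ᵥ c = 0 → c = 0
  selfAdjoint_α : Ω.α₁ * Ω.α₂ᴴ = Ω.α₂ * Ω.α₁ᴴ
  diag_β₁ : Ω.β₁.IsDiag
  diag_β₂ : Ω.β₂.IsDiag
  β_ne_zero : ∀ i, Ω.β₁ i i ≠ 0 ∨ Ω.β₂ i i ≠ 0
  selfAdjoint_β : ∀ i, Ω.β₁ i i * star (Ω.β₂ i i) = Ω.β₂ i i * star (Ω.β₁ i i)

open scoped ComplexOrder in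
lemma eq_zero_of_rank_fromCols {A B : Matrix (Fin n) (Fin n) ℂ}
    (h : (Matrix.fromCols A B).rank = n) {c : Fin n → ℂ} (hA : Aᴴ *ᵥ c = 0) (hB : Bᴴ *ᵥ c = 0) :
    c = 0 := by
  have hr : (Matrix.fromCols A B)ᴴ.rank = n := by rw [Matrix.rank_conjTranspose, h]
  have hk : LinearMap.ker (Matrix.fromCols A B)ᴴ.mulVecLin = ⊥ := by
    have := LinearMap.finrank_range_add_finrank_ker (Matrix.fromCols A B)ᴴ.mulVecLin
    rw [show Module.finrank ℂ (LinearMap.range (Matrix.fromCols A B)ᴴ.mulVecLin) = n from hr,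
      Module.finrank_fin_fun] at this
    exact Submodule.finrank_eq_zero.1 (by omega)
  refine Matrix.ker_mulVecLin_eq_bot_iff.1 hk c ?_
  rw [Matrix.conjTranspose_fromCols_eq_fromRows_conjTranspose, Matrix.fromRows_mulVec, hA, hB]
  ext (i | i) <;> rfl

lemma isDiag_mulVec {A : Matrix (Fin n) (Fin n) ℂ} (hA : A.IsDiag) (x : Fin n → ℂ) (i : Fin n) :
    (A *ᵥ x) i = A i i * x i := by
  rw [Matrix.mulVec, dotProduct, Finset.sum_eq_single i (fun j _ hj => by
    rw [hA hj.symm, zero_mul]) (by simp)]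

lemma IsAdmissible.isRegular {Ω : StarGraph n} (h : Ω.IsAdmissible) : Ω.IsRegular where
  left_lt_right := h.left_lt_right
  integrable_V := h.integrable_V
  eq_zero_of_α _ := eq_zero_of_rank_fromCols h.rank_α
  selfAdjoint_α := h.selfAdjoint_α
  diag_β₁ := h.diag_β₁
  diag_β₂ := h.diag_β₂
  β_ne_zero i := by
    by_contra! hi
    -- If both diagonal entries vanished, the `i`-th basis vector would lie in both adjoint kernels,
    -- against the rank condition.
    have hz : ∀ A : Matrix (Fin n) (Fin n) ℂ, A.IsDiag → A i i = 0 →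
        Aᴴ *ᵥ (Pi.single i 1) = 0 := by
      intro A hA hAi
      ext k
      rw [isDiag_mulVec hA.conjTranspose]
      rcases eq_or_ne k i with rfl | hk <;> simp [*]
    simpa using congrFun (eq_zero_of_rank_fromCols h.rank_β (hz _ h.diag_β₁ hi.1)
      (hz _ h.diag_β₂ hi.2)) i
  selfAdjoint_β i := by
    have := congrFun (congrFun h.selfAdjoint_β i) i
    rw [Matrix.mul_apply, Matrix.mul_apply,
      Finset.sum_eq_single i (fun j _ hj => by rw [h.diag_β₁ hj.symm, zero_mul]) (by simp),
      Finset.sum_eq_single i (fun j _ hj => by rw [h.diag_β₂ hj.symm, zero_mul]) (by simp)] at this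
    simpa using this

lemma IsRegular.outer {Ω : StarGraph n} (h : Ω.IsRegular) (j : Fin n) {s : ℝ}
    (hs : Ω.left j < s) (hs' : s < Ω.right j) : (Ω.outer j s).IsRegular where
  left_lt_right _ := hs'
  integrable_V _ := (h.integrable_V j).mono_set (Icc_subset_Icc_left hs.le)
  eq_zero_of_α c h₁ _ := by simpa [StarGraph.outer] using h₁
  selfAdjoint_α := by simp [StarGraph.outer]
  diag_β₁ i k hik := (hik (Subsingleton.elim i k)).elim
  diag_β₂ i k hik := (hik (Subsingleton.elim i k)).elim
  β_ne_zero _ := h.β_ne_zero j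
  selfAdjoint_β _ := h.selfAdjoint_β j

lemma IsRegular.inner {Ω : StarGraph n} (h : Ω.IsRegular) (j : Fin n) {s : ℝ}
    (hs : Ω.left j < s) (hs' : s < Ω.right j) : (Ω.inner j s).IsRegular where
  left_lt_right i := by
    rcases eq_or_ne i j with rfl | hi
    · simpa [StarGraph.inner] using hs
    · simpa [StarGraph.inner, hi] using h.left_lt_right i
  integrable_V i := by
    refine (h.integrable_V i).mono_set (Icc_subset_Icc_right ?_)
    rcases eq_or_ne i j with rfl | hi
    · simpa [StarGraph.inner] using hs'.le
    · simp [StarGraph.inner, hi]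
  eq_zero_of_α := h.eq_zero_of_α
  selfAdjoint_α := h.selfAdjoint_α
  diag_β₁ i k hik := by
    rcases eq_or_ne i j with rfl | hi
    · simp [StarGraph.inner, hik.symm]
    · simpa [StarGraph.inner, hi] using h.diag_β₁ hik
  diag_β₂ i k hik := by
    rcases eq_or_ne i j with rfl | hi
    · simp [StarGraph.inner]
    · simpa [StarGraph.inner, hi] using h.diag_β₂ hik
  β_ne_zero i := by
    rcases eq_or_ne i j with rfl | hi
    · simp [StarGraph.inner]
    · simpa [StarGraph.inner, hi] using h.β_ne_zero i
  selfAdjoint_β i := by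
    rcases eq_or_ne i j with rfl | hi
    · simp [StarGraph.inner]
    · simpa [StarGraph.inner, hi] using h.selfAdjoint_β i

/-! ### Solutions on a single edge. -/

section Edge

variable {Ω : StarGraph n} {lam : ℂ} {i : Fin n} {u v : ℝ → ℂ}

lemma edgeDeriv_eq (hlt : Ω.left i < Ω.right i)
    (h : IsSol (fun t => Ω.V i t - lam) (Ω.left i) (Ω.right i) u v) {w : ℝ → ℂ}
    (hw : EqOn w u (Ω.edge i)) {x : ℝ} (hx : x ∈ Ω.edge i) : Ω.edgeDeriv i w x = v x := by
  rw [edgeDeriv, derivWithin_congr hw (hw hx)]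
  exact (h.hasDeriv x hx).derivWithin (uniqueDiffOn_Icc hlt x hx)

lemma IsRegular.integrableOn_coeff (hΩ : Ω.IsRegular) (lam : ℂ) (i : Fin n) :
    IntegrableOn (fun t => Ω.V i t - lam) (Icc (Ω.left i) (Ω.right i)) :=
  (hΩ.integrable_V i).sub (integrableOn_const (by simp [edge]))

lemma solvesOnEdge_of_isSol (hlt : Ω.left i < Ω.right i)
    (h : IsSol (fun t => Ω.V i t - lam) (Ω.left i) (Ω.right i) u v) :
    Ω.SolvesOnEdge i u (fun t => lam * u t) := by
  refine ⟨fun x hx => (h.hasDeriv x hx).differentiableWithinAt, fun x hx => ?_⟩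
  rw [edgeDeriv_eq hlt h (eqOn_refl _ _) hx,
    edgeDeriv_eq hlt h (eqOn_refl _ _) (left_mem_Icc.2 hlt.le), h.eq_integral x hx]
  simp only [sub_mul]

lemma SolvesOnEdge.isSol (h : Ω.SolvesOnEdge i u (fun t => lam * u t)) :
    IsSol (fun t => Ω.V i t - lam) (Ω.left i) (Ω.right i) u (Ω.edgeDeriv i u) where
  hasDeriv x hx := (h.1 x hx).hasDerivWithinAt
  eq_integral x hx := by
    simp only [sub_mul]
    exact h.2 x hx

lemma ivpSol_spec (hΩ : Ω.IsRegular) (lam : ℂ) {c : ℝ} (hc : c ∈ Ω.edge i) (p r : ℂ) :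
    IsSol (fun t => Ω.V i t - lam) (Ω.left i) (Ω.right i) (Ω.ivpSol lam i c p r)
      (Ω.edgeDeriv i (Ω.ivpSol lam i c p r)) ∧ Ω.ivpSol lam i c p r c = p ∧
      Ω.edgeDeriv i (Ω.ivpSol lam i c p r) c = r := by
  have hlt := hΩ.left_lt_right i
  obtain ⟨u, v, h, hu, hv⟩ := exists_isSol hlt (hΩ.integrableOn_coeff lam i) hc p r
  have := Classical.epsilon_spec (p := fun u : ℝ → ℂ =>
    Ω.SolvesOnEdge i u (fun t => lam * u t) ∧ u c = p ∧ Ω.edgeDeriv i u c = r)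
    ⟨u, solvesOnEdge_of_isSol hlt h, hu, by rw [edgeDeriv_eq hlt h (eqOn_refl _ _) hc, hv]⟩
  exact ⟨this.1.isSol, this.2⟩

lemma ivpSol_eq (hΩ : Ω.IsRegular)
    (h : IsSol (fun t => Ω.V i t - lam) (Ω.left i) (Ω.right i) u v) {c : ℝ} (hc : c ∈ Ω.edge i)
    {x : ℝ} (hx : x ∈ Ω.edge i) : Ω.ivpSol lam i c (u c) (v c) x = u x ∧
      Ω.edgeDeriv i (Ω.ivpSol lam i c (u c) (v c)) x = v x := by
  obtain ⟨h₁, h₂, h₃⟩ := ivpSol_spec hΩ lam hc (u c) (v c)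
  exact h₁.eq_of_eq h (hΩ.left_lt_right i) (hΩ.integrableOn_coeff lam i) hc h₂ h₃ hx

end Edge

/-! ### Unique solvability at points of the resolvent set. -/

section BoundaryValueProblem

variable {Ω : StarGraph n} {lam : ℂ}

lemma trace_eq (hΩ : Ω.IsRegular) {u v : Fin n → ℝ → ℂ}
    (h : ∀ i, IsSol (fun t => Ω.V i t - lam) (Ω.left i) (Ω.right i) (u i) (v i)) :
    Ω.trace u = Sum.elim
      (Ω.β₁ *ᵥ (fun i => u i (Ω.right i)) + Ω.β₂ *ᵥ (fun i => v i (Ω.right i)))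
      (Ω.α₁ *ᵥ (fun i => u i (Ω.left i)) + Ω.α₂ *ᵥ (fun i => v i (Ω.left i))) := by
  have hl : ∀ i, Ω.edgeDeriv i (u i) (Ω.left i) = v i (Ω.left i) := fun i =>
    edgeDeriv_eq (hΩ.left_lt_right i) (h i) (eqOn_refl _ _)
      (left_mem_Icc.2 (hΩ.left_lt_right i).le)
  have hr : ∀ i, Ω.edgeDeriv i (u i) (Ω.right i) = v i (Ω.right i) := fun i =>
    edgeDeriv_eq (hΩ.left_lt_right i) (h i) (eqOn_refl _ _)
      (right_mem_Icc.2 (hΩ.left_lt_right i).le)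
  simp only [trace, hl, hr]

/-- A family of solutions solves the homogeneous central condition if its data at the central
vertex are in the span of the columns of `-α₂ᴴ`, `α₁ᴴ`. -/
lemma isBVPSol_of_data (hΩ : Ω.IsRegular) {u v : Fin n → ℝ → ℂ}
    (h : ∀ i, IsSol (fun t => Ω.V i t - lam) (Ω.left i) (Ω.right i) (u i) (v i))
    {y g : Fin n → ℂ} (hu : ∀ i, u i (Ω.left i) = (Ω.α₂ᴴ *ᵥ y) i)
    (hv : ∀ i, v i (Ω.left i) = -(Ω.α₁ᴴ *ᵥ y) i)
    (hg : ∀ i, Ω.β₁ i i * u i (Ω.right i) + Ω.β₂ i i * v i (Ω.right i) = g i) :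
    Ω.IsBVPSol lam (Sum.elim g 0) u := by
  refine ⟨fun i => solvesOnEdge_of_isSol (hΩ.left_lt_right i) (h i), ?_⟩
  rw [trace_eq hΩ h]
  congr 1
  · ext i
    rw [Pi.add_apply, isDiag_mulVec hΩ.diag_β₁, isDiag_mulVec hΩ.diag_β₂, hg]
  · rw [funext hu, funext hv]
    change Ω.α₁ *ᵥ (Ω.α₂ᴴ *ᵥ y) + Ω.α₂ *ᵥ (-(Ω.α₁ᴴ *ᵥ y)) = 0
    rw [Matrix.mulVec_neg, Matrix.mulVec_mulVec, Matrix.mulVec_mulVec, hΩ.selfAdjoint_α,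
      add_neg_cancel]

/-- A point of the resolvent set is not an eigenvalue. -/
lemma eq_zero_of_mem_resolventSet (hΩ : Ω.IsRegular) (hlam : lam ∈ Ω.resolventSet)
    {u : Fin n → ℝ → ℂ} (hu : Ω.IsBVPSol lam 0 u) (i : Fin n) : EqOn (u i) 0 (Ω.edge i) := by
  have hc : ∀ i, ContinuousOn (u i) (Ω.edge i) := fun i => (hu.1 i).1.continuousOn
  have hm : ∀ i, MemLp (u i) 2 (volume.restrict (Ω.edge i)) := fun i => by
    have : IsFiniteMeasure (volume.restrict (Ω.edge i)) :=
      ⟨by simp [edge]⟩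
    obtain ⟨C, hC⟩ := isCompact_Icc.exists_bound_of_continuousOn (hc i)
    exact MemLp.of_bound ((hc i).aestronglyMeasurable measurableSet_Icc) C
      ((ae_restrict_iff' measurableSet_Icc).2 (Eventually.of_forall hC))
  obtain ⟨R, hR⟩ := hlam
  let p : Ω.L2 := WithLp.toLp 2 fun i => (hm i).toLp (u i)
  have hp : ∀ i, (p i : ℝ → ℂ) =ᵐ[volume.restrict (Ω.edge i)] u i := fun i => (hm i).coeFn_toLp
  have hq : ∀ i, ((0 + lam • p : Ω.L2) i : ℝ → ℂ) =ᵐ[volume.restrict (Ω.edge i)]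
      fun t => lam * u i t := fun i => by
    rw [zero_add]
    filter_upwards [hp i, Lp.coeFn_smul lam (p i)] with t h₁ h₂
    rw [PiLp.smul_apply, h₂, Pi.smul_apply, h₁, smul_eq_mul]
  have hmem : (p, 0 + lam • p) ∈ Ω.operatorGraph := by
    -- The second component is only an almost everywhere representative of `lam * u`, which the
    -- integral does not notice.
    refine ⟨u, hp, fun i => ⟨(hu.1 i).1, fun x hx => ?_⟩, hu.2⟩
    rw [(hu.1 i).2 x hx]
    congr 1
    refine intervalIntegral.integral_congr_ae_restrict ?_
    have hsub : uIoc (Ω.left i) x ⊆ Ω.edge i := by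
      rw [uIoc_of_le hx.1]
      exact Ioc_subset_Icc_self.trans (Icc_subset_Icc_right hx.2)
    filter_upwards [ae_restrict_of_ae_restrict_of_subset hsub (hq i)] with t ht
    rw [ht]
  have hp0 : p = 0 := by rw [(hR p 0).1 hmem, map_zero]
  have h0 : u i =ᵐ[volume.restrict (Ω.edge i)] 0 := by
    have h1 := hp i
    rw [hp0] at h1
    exact h1.symm.trans (Lp.coeFn_zero _ _ _)
  exact Measure.eqOn_Icc_of_ae_eq volume (hΩ.left_lt_right i).ne h0 (hc i) continuousOn_const

/-- Solutions are parametrized by their `2n` initial data at the left ends, and the trace is a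
linear map of these data into a space of the same dimension. It is injective since `lam` is not an
eigenvalue, hence surjective. -/
lemma wellPosed_of_mem_resolventSet (hΩ : Ω.IsRegular) (hlam : lam ∈ Ω.resolventSet) :
    Ω.WellPosed lam := by
  have hlt := hΩ.left_lt_right
  have hq := hΩ.integrableOn_coeff lam
  choose C C' hC hC₀ hC₁ using fun i => exists_isSol_left (hlt i) (hq i) 1 0
  choose S S' hS hS₀ hS₁ using fun i => exists_isSol_left (hlt i) (hq i) 0 1
  let U : (Fin n ⊕ Fin n → ℂ) → Fin n → ℝ → ℂ := fun D i x =>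
    D (Sum.inl i) * C i x + D (Sum.inr i) * S i x
  let U' : (Fin n ⊕ Fin n → ℂ) → Fin n → ℝ → ℂ := fun D i x =>
    D (Sum.inl i) * C' i x + D (Sum.inr i) * S' i x
  have hU : ∀ D i, IsSol (fun t => Ω.V i t - lam) (Ω.left i) (Ω.right i) (U D i) (U' D i) :=
    fun D i => (hC i).linComb (hS i) (hq i) _ _
  have hbvp : ∀ D, Ω.IsBVPSol lam (Ω.trace (U D)) (U D) := fun D =>
    ⟨fun i => solvesOnEdge_of_isSol (hlt i) (hU D i), rfl⟩
  let T : (Fin n ⊕ Fin n → ℂ) →ₗ[ℂ] (Fin n ⊕ Fin n → ℂ) :=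
    { toFun := fun D => Ω.trace (U D)
      map_add' := fun D E => by
        simp only [trace_eq hΩ (hU _)]
        ext (i | i) <;>
        simp only [U, U', Matrix.mulVec, dotProduct, Pi.add_apply, Sum.elim_inl, Sum.elim_inr,
          mul_add, add_mul, Finset.sum_add_distrib] <;> ring
      map_smul' := fun c D => by
        simp only [trace_eq hΩ (hU _)]
        ext (i | i) <;>
        simp only [U, U', Matrix.mulVec, dotProduct, Pi.add_apply, Pi.smul_apply, smul_eq_mul,
          Sum.elim_inl, Sum.elim_inr, RingHom.id_apply, mul_add, Finset.mul_sum,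
          Finset.sum_add_distrib, mul_assoc, mul_left_comm _ c] }
  have hzero : ∀ u, Ω.IsBVPSol lam 0 u → ∀ i, EqOn (u i) 0 (Ω.edge i) :=
    fun u hu i => eq_zero_of_mem_resolventSet hΩ hlam hu i
  have hinj : Function.Injective T := by
    rw [injective_iff_map_eq_zero]
    intro D hD
    have h0 : Ω.IsBVPSol lam 0 (U D) := by
      have := hbvp D
      rwa [show Ω.trace (U D) = 0 from hD] at this
    have hl : ∀ i, Ω.left i ∈ Ω.edge i := fun i => left_mem_Icc.2 (hlt i).le
    ext (i | i)
    · simpa [U, hC₀, hS₀] using hzero _ h0 i (hl i)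
    · have h1 := edgeDeriv_eq (hlt i) (hU D i) (eqOn_refl _ _) (hl i)
      have h2 : Ω.edgeDeriv i (U D i) (Ω.left i) = 0 := by
        rw [edgeDeriv, derivWithin_congr (hzero _ h0 i) (hzero _ h0 i (hl i))]
        simp
      rw [h2] at h1
      simpa [U', hC₁, hS₁] using h1.symm
  intro g
  obtain ⟨D, hD⟩ := LinearMap.injective_iff_surjective.1 hinj g
  refine ⟨U D, by rw [← hD]; exact hbvp D, fun w hw i x hx => ?_⟩
  have hdiff : ∀ i, IsSol (fun t => Ω.V i t - lam) (Ω.left i) (Ω.right i)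
      (fun x => 1 * w i x + (-1) * U D i x)
      (fun x => 1 * Ω.edgeDeriv i (w i) x + (-1) * U' D i x) :=
    fun i => (hw.1 i).isSol.linComb (hU D i) (hq i) _ _
  have h0 : Ω.IsBVPSol lam 0 fun i x => 1 * w i x + (-1) * U D i x := by
    refine ⟨fun i => solvesOnEdge_of_isSol (hlt i) (hdiff i), ?_⟩
    have e₁ := hw.2
    have e₂ : Ω.trace (U D) = g := hD
    rw [trace_eq hΩ fun i => (hw.1 i).isSol] at e₁
    rw [trace_eq hΩ (hU D), ← e₁] at e₂
    rw [trace_eq hΩ hdiff]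
    ext (k | k)
    · have := congrFun e₂ (Sum.inl k)
      simp only [Matrix.mulVec, dotProduct, Pi.add_apply, Sum.elim_inl, mul_add,
        Finset.sum_add_distrib, one_mul, neg_mul, mul_neg, Finset.sum_neg_distrib,
        Pi.zero_apply] at this ⊢
      linear_combination -this
    · have := congrFun e₂ (Sum.inr k)
      simp only [Matrix.mulVec, dotProduct, Pi.add_apply, Sum.elim_inr, mul_add,
        Finset.sum_add_distrib, one_mul, neg_mul, mul_neg, Finset.sum_neg_distrib,
        Pi.zero_apply] at this ⊢
      linear_combination -this
  have := hzero _ h0 i hx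
  simp only [Pi.zero_apply] at this
  linear_combination this

/-- Lets the chosen solution be replaced by any explicit one: by uniqueness they agree on the edge,
and the derivative within the edge sees nothing else. -/
lemma bvpSol_eq (hΩ : Ω.IsRegular) (hwp : Ω.WellPosed lam) {g : Fin n ⊕ Fin n → ℂ}
    {u v : Fin n → ℝ → ℂ} (hu : Ω.IsBVPSol lam g u) {i : Fin n}
    (h : IsSol (fun t => Ω.V i t - lam) (Ω.left i) (Ω.right i) (u i) (v i))
    {x : ℝ} (hx : x ∈ Ω.edge i) : Ω.edgeDeriv i (Ω.bvpSol lam g i) x = v i x := by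
  obtain ⟨w, -, huniq⟩ := hwp g
  have hb : Ω.IsBVPSol lam g (Ω.bvpSol lam g) := Classical.epsilon_spec ⟨u, hu⟩
  exact edgeDeriv_eq (hΩ.left_lt_right i) h
    (fun y hy => (huniq _ hb i hy).trans (huniq _ hu i hy).symm) hx

end BoundaryValueProblem

/-! ### Determinants after replacing one or two columns. -/

section Determinants

variable {m : Type*} [Fintype m] [DecidableEq m]

/-- `F` is `G` times the identity with column `j` replaced by `c`. -/
lemma det_eq_of_col_eq_mulVec {G F : Matrix m m ℂ} {j : m} {c : m → ℂ}
    (hF : ∀ a k, k ≠ j → F a k = G a k) (hj : ∀ a, F a j = (G *ᵥ c) a) :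
    F.det = G.det * c j := by
  have hFG : F = G * (1 : Matrix m m ℂ).updateCol j c := by
    ext a k
    rw [Matrix.mul_apply]
    rcases eq_or_ne k j with rfl | hk
    · simp [hj, Matrix.mulVec, dotProduct]
    · simp [hF a k hk, hk, Matrix.one_apply]
  rw [hFG, Matrix.det_mul, ← Matrix.cramer_apply, Matrix.cramer_one]
  rfl

lemma det_eq_of_two_cols_eq_mulVec {G F : Matrix m m ℂ} {j k : m} (hjk : j ≠ k) {c d : m → ℂ}
    (hF : ∀ a l, l ≠ j → l ≠ k → F a l = G a l) (hj : ∀ a, F a j = (G *ᵥ c) a)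
    (hk : ∀ a, F a k = (G *ᵥ d) a) :
    F.det = G.det * (c j * d k - c k * d j) := by
  let U : Matrix m (Fin 2) ℂ := Matrix.of fun a t =>
    ![c a - (1 : Matrix m m ℂ) a j, d a - (1 : Matrix m m ℂ) a k] t
  let V : Matrix (Fin 2) m ℂ := Matrix.of fun t a =>
    ![(1 : Matrix m m ℂ) j a, (1 : Matrix m m ℂ) k a] t
  have hFG : F = G * (1 + U * V) := by
    ext a l
    rw [Matrix.mul_apply]
    simp only [Matrix.add_apply, Matrix.mul_apply (M := U), Fin.sum_univ_two]
    rcases eq_or_ne l j with rfl | hlj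
    · simp [U, V, hj, Matrix.mulVec, dotProduct, hjk.symm]
    · rcases eq_or_ne l k with rfl | hlk
      · simp [U, V, hk, Matrix.mulVec, dotProduct, hjk]
      · simp [U, V, hF a l hlj hlk, hlj.symm, hlk.symm, Matrix.one_apply]
  -- `det (1 + U * V) = det (1 + V * U)` reduces the rank-two update to a `2 × 2` determinant.
  rw [hFG, Matrix.det_mul, Matrix.det_one_add_mul_comm, Matrix.det_fin_two]
  congr 1
  simp [U, V, Matrix.mul_apply, Matrix.one_apply, hjk, hjk.symm, mul_comm]

end Determinants

/-! ### The Evans function as a determinant of central data. -/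

/-- The matrix of the data at the central vertex of the solutions satisfying the central condition
and of the solutions, with data `z`, `z'`, satisfying the outer conditions. -/
def dataMatrix (Ω : StarGraph n) (z z' : Fin n → ℂ) :
    Matrix (Fin n ⊕ Fin n) (Fin n ⊕ Fin n) ℂ :=
  Matrix.fromBlocks (-Ω.α₂ᴴ) (Matrix.diagonal z) Ω.α₁ᴴ (Matrix.diagonal z')

lemma dataMatrix_mulVec_inl (Ω : StarGraph n) (z z' : Fin n → ℂ) (c : Fin n ⊕ Fin n → ℂ)
    (i : Fin n) : (Ω.dataMatrix z z' *ᵥ c) (Sum.inl i) =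
      -(Ω.α₂ᴴ *ᵥ (c ∘ Sum.inl)) i + z i * c (Sum.inr i) := by
  simp [dataMatrix, Matrix.fromBlocks_mulVec, Matrix.neg_mulVec, Matrix.mulVec_diagonal]

lemma dataMatrix_mulVec_inr (Ω : StarGraph n) (z z' : Fin n → ℂ) (c : Fin n ⊕ Fin n → ℂ)
    (i : Fin n) : (Ω.dataMatrix z z' *ᵥ c) (Sum.inr i) =
      (Ω.α₁ᴴ *ᵥ (c ∘ Sum.inl)) i + z' i * c (Sum.inr i) := by
  simp [dataMatrix, Matrix.fromBlocks_mulVec, Matrix.mulVec_diagonal]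

/-- `z`, with derivative `z'`, is the solution with data `-β₂*`, `β₁*` at the outer vertex of
edge `i`. -/
structure IsOuterSol (Ω : StarGraph n) (lam : ℂ) (i : Fin n) (z z' : ℝ → ℂ) : Prop where
  isSol : IsSol (fun t => Ω.V i t - lam) (Ω.left i) (Ω.right i) z z'
  right_eq : z (Ω.right i) = -star (Ω.β₂ i i)
  deriv_right_eq : z' (Ω.right i) = star (Ω.β₁ i i)

section Evans

variable {Ω : StarGraph n} {lam : ℂ} {z z' : Fin n → ℝ → ℂ}

lemma IsOuterSol.outer_condition (hΩ : Ω.IsRegular) {i : Fin n} {z z' : ℝ → ℂ}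
    (h : Ω.IsOuterSol lam i z z') :
    Ω.β₁ i i * z (Ω.right i) + Ω.β₂ i i * z' (Ω.right i) = 0 := by
  rw [h.right_eq, h.deriv_right_eq]
  linear_combination -hΩ.selfAdjoint_β i

lemma exists_isOuterSol (hΩ : Ω.IsRegular) (lam : ℂ) :
    ∃ z z' : Fin n → ℝ → ℂ, ∀ i, Ω.IsOuterSol lam i (z i) (z' i) := by
  choose z z' h h₁ h₂ using fun i => exists_isSol (hΩ.left_lt_right i)
    (hΩ.integrableOn_coeff lam i) (right_mem_Icc.2 (hΩ.left_lt_right i).le)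
    (-star (Ω.β₂ i i)) (star (Ω.β₁ i i))
  exact ⟨z, z', fun i => ⟨h i, h₁ i, h₂ i⟩⟩

lemma evans_eq_det_dataMatrix (hΩ : Ω.IsRegular) (hz : ∀ i, Ω.IsOuterSol lam i (z i) (z' i)) :
    Ω.evans lam =
      (Ω.dataMatrix (fun i => z i (Ω.left i)) (fun i => z' i (Ω.left i))).det := by
  have hl : ∀ i, Ω.left i ∈ Ω.edge i := fun i => left_mem_Icc.2 (hΩ.left_lt_right i).le
  have hr : ∀ i, Ω.right i ∈ Ω.edge i := fun i => right_mem_Icc.2 (hΩ.left_lt_right i).le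
  have hY := fun i k => (ivpSol_spec hΩ lam (hl i) (-(Ω.α₂ᴴ i k)) (Ω.α₁ᴴ i k)).2
  have hZ : ∀ i k, Ω.solZ lam i k (Ω.left i) =
      Matrix.diagonal (fun i => z i (Ω.left i)) i k ∧
      Ω.edgeDeriv i (Ω.solZ lam i k) (Ω.left i) =
      Matrix.diagonal (fun i => z' i (Ω.left i)) i k := by
    intro i k
    rcases eq_or_ne i k with rfl | hik
    · have := ivpSol_eq hΩ (hz i).isSol (hr i) (hl i)
      rw [(hz i).right_eq, (hz i).deriv_right_eq] at this
      simpa [solZ, Matrix.conjTranspose_apply] using this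
    -- Off the diagonal the data at the outer vertex vanish, because `β₁`, `β₂` are diagonal.
    · have := ivpSol_eq hΩ ((hz i).isSol.const_mul 0) (hr i) (hl i)
      simpa [solZ, Matrix.conjTranspose_apply, hΩ.diag_β₁ hik.symm, hΩ.diag_β₂ hik.symm, hik]
        using this
  rw [evans]
  congr 1
  ext (i | i) (k | k)
  · simpa [fundamentalMatrix, dataMatrix, solY] using (hY i k).1
  · simpa [fundamentalMatrix, dataMatrix] using (hZ i k).1
  · simpa [fundamentalMatrix, dataMatrix, solY] using (hY i k).2
  · simpa [fundamentalMatrix, dataMatrix] using (hZ i k).2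

/-- A null vector `c` of the data matrix gives the homogeneous solution `c (Sum.inr i) * z i`, which
is zero by uniqueness. Its data at the outer vertices force the second half of `c` to vanish, and
the condition on `α₁`, `α₂` then kills the first half. -/
lemma evans_ne_zero (hΩ : Ω.IsRegular) (hwp : Ω.WellPosed lam) : Ω.evans lam ≠ 0 := by
  obtain ⟨z, z', hz⟩ := exists_isOuterSol hΩ lam
  rw [evans_eq_det_dataMatrix hΩ hz]
  intro hdet
  obtain ⟨c, hc, hGc⟩ := Matrix.exists_mulVec_eq_zero_iff.2 hdet
  have h₁ : ∀ i, c (Sum.inr i) * z i (Ω.left i) = (Ω.α₂ᴴ *ᵥ (c ∘ Sum.inl)) i := fun i => by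
    have := (dataMatrix_mulVec_inl ..).symm.trans (congrFun hGc (Sum.inl i))
    simp only [Pi.zero_apply] at this
    linear_combination this
  have h₂ : ∀ i, c (Sum.inr i) * z' i (Ω.left i) = -(Ω.α₁ᴴ *ᵥ (c ∘ Sum.inl)) i := fun i => by
    have := (dataMatrix_mulVec_inr ..).symm.trans (congrFun hGc (Sum.inr i))
    simp only [Pi.zero_apply] at this
    linear_combination this
  have hs := fun i => (hz i).isSol.const_mul (c (Sum.inr i))
  have hu := isBVPSol_of_data hΩ hs (g := 0) h₁ h₂ fun i => by
    have := (hz i).outer_condition hΩ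
    simp only [Pi.zero_apply]
    linear_combination c (Sum.inr i) * this
  have hzero := isBVPSol_of_data hΩ (fun i => (hz i).isSol.const_mul 0) (y := 0) (g := 0)
    (by simp) (by simp) (by simp)
  obtain ⟨w, -, huniq⟩ := hwp (Sum.elim 0 0)
  have hr : ∀ i, Ω.right i ∈ Ω.edge i := fun i => right_mem_Icc.2 (hΩ.left_lt_right i).le
  have heq : ∀ i, EqOn (fun x => c (Sum.inr i) * z i x) (fun x => 0 * z i x) (Ω.edge i) :=
    fun i x hx => (huniq _ hu i hx).trans (huniq _ hzero i hx).symm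
  have hd : ∀ i, c (Sum.inr i) = 0 := fun i => by
    have e₁ := heq i (hr i)
    have e₂ := (edgeDeriv_eq (hΩ.left_lt_right i) (hs i) (eqOn_refl _ _) (hr i)).symm.trans
      (edgeDeriv_eq (hΩ.left_lt_right i) ((hz i).isSol.const_mul 0) (heq i) (hr i))
    simp only [(hz i).right_eq, (hz i).deriv_right_eq, zero_mul, mul_eq_zero, neg_eq_zero,
      star_eq_zero] at e₁ e₂
    rcases hΩ.β_ne_zero i with h | h
    · exact e₂.resolve_right h
    · exact e₁.resolve_right h
  have hy : c ∘ Sum.inl = 0 := hΩ.eq_zero_of_α _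
    (funext fun i => by have := h₂ i; rw [hd, zero_mul] at this; simpa using this.symm)
    (funext fun i => by have := h₁ i; rw [hd, zero_mul] at this; simpa using this.symm)
  refine hc (funext fun k => ?_)
  rcases k with i | i
  · exact congrFun hy i
  · exact hd i

/-- Subtracting `c (Sum.inr i) * z i` from `p i` keeps the outer data `g`; by the choice of `c`, the
remaining central data lie in the span of the columns `(-α₂ᴴ, α₁ᴴ)`, so the central condition holds.
-/
lemma edgeDeriv_bvpSol_eq (hΩ : Ω.IsRegular) (hwp : Ω.WellPosed lam)
    (hz : ∀ i, Ω.IsOuterSol lam i (z i) (z' i)) {p p' : Fin n → ℝ → ℂ}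
    (hp : ∀ i, IsSol (fun t => Ω.V i t - lam) (Ω.left i) (Ω.right i) (p i) (p' i))
    {c : Fin n ⊕ Fin n → ℂ}
    (hc : Ω.dataMatrix (fun i => z i (Ω.left i)) (fun i => z' i (Ω.left i)) *ᵥ c =
      Sum.elim (fun i => p i (Ω.left i)) (fun i => p' i (Ω.left i)))
    {g : Fin n → ℂ} (hg : ∀ i, Ω.β₁ i i * p i (Ω.right i) + Ω.β₂ i i * p' i (Ω.right i) = g i)
    (j : Fin n) : Ω.edgeDeriv j (Ω.bvpSol lam (Sum.elim g 0) j) (Ω.right j) =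
      p' j (Ω.right j) - c (Sum.inr j) * star (Ω.β₁ j j) := by
  have hs : ∀ i, IsSol (fun t => Ω.V i t - lam) (Ω.left i) (Ω.right i)
      (fun x => 1 * p i x + -c (Sum.inr i) * z i x)
      (fun x => 1 * p' i x + -c (Sum.inr i) * z' i x) := fun i =>
    (hp i).linComb (hz i).isSol (hΩ.integrableOn_coeff lam i) _ _
  have hu := isBVPSol_of_data hΩ hs (y := -(c ∘ Sum.inl)) (g := g) (fun i => ?_) (fun i => ?_)
    (fun i => ?_)
  · rw [bvpSol_eq hΩ hwp hu (v := fun i x => 1 * p' i x + -c (Sum.inr i) * z' i x) (hs j) (right_mem_Icc.2 (hΩ.left_lt_right j).le),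
      (hz j).deriv_right_eq]
    ring
  · have := (dataMatrix_mulVec_inl ..).symm.trans (congrFun hc (Sum.inl i))
    simp only [Sum.elim_inl] at this
    rw [Matrix.mulVec_neg, Pi.neg_apply]
    linear_combination -this
  · have := (dataMatrix_mulVec_inr ..).symm.trans (congrFun hc (Sum.inr i))
    simp only [Sum.elim_inr] at this
    rw [Matrix.mulVec_neg, Pi.neg_apply]
    linear_combination -this
  · have := (hz i).outer_condition hΩ
    linear_combination hg i - c (Sum.inr i) * this

/-- Shortening some edges of `Ω`, with Dirichlet conditions at the cuts, gives `B`. The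
Dirichlet-to-Neumann matrix `N` of `B` relates the Evans functions of `Ω` and `B`. -/
lemma exists_dirichletToNeumann {B : StarGraph n} (hΩ : Ω.IsRegular) (hB : B.IsRegular)
    (hwp : B.WellPosed lam) (hleft : B.left = Ω.left) (hV : B.V = Ω.V) (hα₁ : B.α₁ = Ω.α₁)
    (hα₂ : B.α₂ = Ω.α₂) (hright : ∀ i, B.right i ≤ Ω.right i) {s : Set (Fin n)}
    (hin : ∀ i ∈ s, B.β₁ i i = 1 ∧ B.β₂ i i = 0)
    (hout : ∀ i ∉ s, B.right i = Ω.right i ∧ B.β₁ i i = Ω.β₁ i i ∧ B.β₂ i i = Ω.β₂ i i)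
    (hz : ∀ i, Ω.IsOuterSol lam i (z i) (z' i)) :
    ∃ N : Matrix (Fin n) (Fin n) ℂ,
      (∀ g : Fin n → ℂ, (∀ i ∉ s, g i = 0) → ∀ j ∈ s,
        B.edgeDeriv j (B.bvpSol lam (Sum.elim g 0) j) (B.right j) = (N *ᵥ g) j) ∧
      (∀ j, s = {j} → Ω.evans lam =
        B.evans lam * (z' j (B.right j) - N j j * z j (B.right j))) ∧
      ∀ j k, j ≠ k → s = {j, k} → Ω.evans lam = B.evans lam *
        ((z' j (B.right j) - N j j * z j (B.right j)) *
          (z' k (B.right k) - N k k * z k (B.right k)) -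
          N k j * z j (B.right j) * (N j k * z k (B.right k))) := by
  obtain ⟨l, r, V, a₁, a₂, b₁, b₂⟩ := B
  dsimp only at hleft hV hα₁ hα₂ hright hin hout ⊢
  subst hleft hV hα₁ hα₂
  set B : StarGraph n := ⟨Ω.left, r, Ω.V, Ω.α₁, Ω.α₂, b₁, b₂⟩ with hBdef
  have hlt : ∀ i, Ω.left i < r i := hB.left_lt_right
  have hq : ∀ i, IntegrableOn (fun t => Ω.V i t - lam) (Icc (Ω.left i) (r i)) :=
    hB.integrableOn_coeff lam
  have hl : ∀ i, Ω.left i ∈ Icc (Ω.left i) (r i) := fun i => left_mem_Icc.2 (hlt i).le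
  have hr : ∀ i, r i ∈ Icc (Ω.left i) (r i) := fun i => right_mem_Icc.2 (hlt i).le
  obtain ⟨y, y', hy⟩ := exists_isOuterSol hB lam
  -- On a cut edge `y` has data `(0, 1)` at the cut, so `ψ` completes it to a basis there.
  choose ψ ψ' hψ hψ₀ hψ₁ using fun i => exists_isSol (hlt i) (hq i) (hr i) 1 0
  have hzB : ∀ i, IsSol (fun t => Ω.V i t - lam) (Ω.left i) (r i) (z i) (z' i) := fun i =>
    (hz i).isSol.mono (hΩ.integrableOn_coeff lam i) le_rfl (hright i)
  set G := B.dataMatrix (fun i => y i (Ω.left i)) (fun i => y' i (Ω.left i)) with hG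
  have hGdet : B.evans lam = G.det := evans_eq_det_dataMatrix hB hy
  have hGu : IsUnit G.det := by rw [← hGdet]; exact (evans_ne_zero hB hwp).isUnit
  set P : Matrix (Fin n ⊕ Fin n) (Fin n) ℂ := Matrix.fromRows
    (Matrix.diagonal fun i => ψ i (Ω.left i)) (Matrix.diagonal fun i => ψ' i (Ω.left i)) with hP
  -- Column `k` of `K` expands the central data of `ψ k` in the columns of `G`.
  set K := G⁻¹ * P with hK
  have hGK : G * K = P := by rw [hK, ← Matrix.mul_assoc, Matrix.mul_nonsing_inv _ hGu,
    Matrix.one_mul]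
  set F := Ω.dataMatrix (fun i => z i (Ω.left i)) (fun i => z' i (Ω.left i)) with hF
  have hFdet : Ω.evans lam = F.det := evans_eq_det_dataMatrix hΩ hz
  have hcol_inl : ∀ a k, F a (Sum.inl k) = G a (Sum.inl k) := by
    rintro (a | a) k <;> rfl
  have hcol_out : ∀ a, ∀ k ∉ s, F a (Sum.inr k) = G a (Sum.inr k) := by
    intro a k hk
    obtain ⟨h₀, h₁, h₂⟩ := hout k hk
    have := (hzB k).eq_of_eq (hy k).isSol (hlt k) (hq k) (hr k)
      (by
        rw [show y k (r k) = _ from (hy k).right_eq]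
        change z k (r k) = -star (b₂ k k)
        rw [h₀, h₂, (hz k).right_eq])
      (by
        rw [show y' k (r k) = _ from (hy k).deriv_right_eq]
        change z' k (r k) = star (b₁ k k)
        rw [h₀, h₁, (hz k).deriv_right_eq]) (hl k)
    rcases a with a | a <;> rcases eq_or_ne a k with rfl | hak <;>
      simp [dataMatrix, *]
  have hcol_in : ∀ a, ∀ k ∈ s, F a (Sum.inr k) =
      (G *ᵥ (z k (r k) • K.col k + z' k (r k) • Pi.single (Sum.inr k) 1)) a := by
    intro a k hk
    obtain ⟨h₁, h₂⟩ := hin k hk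
    have hyr : y k (r k) = 0 := (hy k).right_eq.trans (by simp [hBdef, h₂])
    have hyr' : y' k (r k) = 1 := (hy k).deriv_right_eq.trans (by simp [hBdef, h₁])
    have := (hzB k).eq_of_eq ((hψ k).linComb (hy k).isSol (hq k) (z k (r k)) (z' k (r k)))
      (hlt k) (hq k) (hr k) (by rw [hψ₀, hyr]; ring) (by rw [hψ₁, hyr']; ring) (hl k)
    have hGKa : (G *ᵥ K.col k) a = P a k := by rw [← hGK]; rfl
    rw [Matrix.mulVec_add, Matrix.mulVec_smul, Matrix.mulVec_smul, Pi.add_apply, Pi.smul_apply,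
      Pi.smul_apply, hGKa, Matrix.mulVec_single_one]
    rcases a with a | a <;> rcases eq_or_ne a k with rfl | hak <;>
      simp [dataMatrix, *]
  -- The solution with data `g` is `g i * ψ i - (K *ᵥ g) (Sum.inr i) * y i`; at a cut `ψ' = 0` and
  -- `y' = 1`, whence the sign.
  refine ⟨Matrix.of fun i k => -K (Sum.inr i) k, fun g hg j hj => ?_, fun j hs => ?_,
    fun j k hjk hs => ?_⟩
  · have hgB : ∀ i, b₁ i i * (g i * ψ i (r i)) + b₂ i i * (g i * ψ' i (r i)) = g i := fun i => by
      by_cases hi : i ∈ s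
      · rw [hψ₀, hψ₁, (hin i hi).1]; ring
      -- `ψ i` need not match the original condition on an uncut edge, but there its coefficient is
      -- zero.
      · rw [hg i hi]; ring
    have hc : G *ᵥ (K *ᵥ g) = Sum.elim (fun i => g i * ψ i (Ω.left i))
        (fun i => g i * ψ' i (Ω.left i)) := by
      rw [Matrix.mulVec_mulVec, hGK, hP, Matrix.fromRows_mulVec]
      ext (i | i) <;> simp [Matrix.mulVec_diagonal, mul_comm]
    have := edgeDeriv_bvpSol_eq hB hwp hy (fun i => (hψ i).const_mul (g i)) hc hgB j
    refine this.trans ?_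
    change g j * ψ' j (r j) - (K *ᵥ g) (Sum.inr j) * star (b₁ j j) = _
    rw [hψ₁, (hin j hj).1]
    simp [Matrix.mulVec, dotProduct]
  · rw [hFdet, hGdet, det_eq_of_col_eq_mulVec (j := Sum.inr j) (fun a k hk => ?_)
      (fun a => hcol_in a j (by simp [hs]))]
    · simp only [Pi.add_apply, Pi.smul_apply, Pi.single_eq_same, smul_eq_mul, Matrix.col_apply,
        Matrix.of_apply]
      ring
    · rcases k with k | k
      · exact hcol_inl a k
      · exact hcol_out a k (by rw [hs]; simpa using hk)
  · rw [hFdet, hGdet, det_eq_of_two_cols_eq_mulVec (j := Sum.inr j) (k := Sum.inr k)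
      (by simpa using hjk) (fun a l hlj hlk => ?_)
      (fun a => hcol_in a j (by simp [hs])) (fun a => hcol_in a k (by simp [hs]))]
    · have hkj : (Sum.inr k : Fin n ⊕ Fin n) ≠ Sum.inr j := by simpa using hjk.symm
      simp only [Pi.add_apply, Pi.smul_apply, Pi.single_eq_same, Pi.single_eq_of_ne hkj,
        Pi.single_eq_of_ne hkj.symm, smul_eq_mul, Matrix.col_apply, Matrix.of_apply]
      ring
    · rcases l with l | l
      · exact hcol_inl a l
      · exact hcol_out a l (by rw [hs]; simp_all)

end Evans

/-! ### The pieces consisting of one interval. -/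

section Outer

variable {Ω : StarGraph n} {lam : ℂ} {j : Fin n} {s : ℝ} {u v z z' : ℝ → ℂ}

/-- The Dirichlet condition at `s` gives the first column `(0, 1)`; the second is `(z s, z' s)`. -/
lemma evans_outer (hA : (Ω.outer j s).IsRegular)
    (hz : IsSol (fun t => Ω.V j t - lam) s (Ω.right j) z z')
    (hr : z (Ω.right j) = -star (Ω.β₂ j j)) (hr' : z' (Ω.right j) = star (Ω.β₁ j j)) :
    (Ω.outer j s).evans lam = -z s := by
  rw [evans_eq_det_dataMatrix hA (z := fun _ => z) (z' := fun _ => z') fun _ => ⟨hz, hr, hr'⟩,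
    ← Matrix.det_reindex_self finSumFinEquiv]
  refine (Matrix.det_fin_two _).trans ?_
  have h0 : finSumFinEquiv.symm (0 : Fin (1 + 1)) = Sum.inl 0 := rfl
  have h1 : finSumFinEquiv.symm (1 : Fin (1 + 1)) = Sum.inr 0 := rfl
  simp [dataMatrix, outer, h0, h1]

lemma edgeDeriv_bvpSol_outer (hA : (Ω.outer j s).IsRegular) (hwp : (Ω.outer j s).WellPosed lam)
    (h : IsSol (fun t => Ω.V j t - lam) s (Ω.right j) u v) {a b : ℂ}
    (ha : Ω.β₁ j j * u (Ω.right j) + Ω.β₂ j j * v (Ω.right j) = a) (hb : u s = b) {x : ℝ}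
    (hx : x ∈ Icc s (Ω.right j)) :
    (Ω.outer j s).edgeDeriv 0
      ((Ω.outer j s).bvpSol lam (Sum.elim (fun _ => a) (fun _ => b)) 0) x = v x := by
  have hs : ∀ i : Fin 1, IsSol (fun t => (Ω.outer j s).V i t - lam) ((Ω.outer j s).left i)
    ((Ω.outer j s).right i) u v := fun _ => h
  refine bvpSol_eq hA hwp (u := fun _ => u) (v := fun _ => v)
    ⟨fun i => solvesOnEdge_of_isSol (hA.left_lt_right i) (hs i), ?_⟩ h hx
  rw [trace_eq hA hs]
  ext (i | i)
  · simpa [outer, Matrix.mulVec, dotProduct] using ha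
  · simpa [outer] using hb

end Outer

/-! ### The two-sided map for each position of the cuts. -/

section Cuts

variable {Ω : StarGraph n} {lam : ℂ}

/-- Two cuts on one wire. -/
lemma exists_matrix_of_one_wire (hΩ : Ω.IsRegular) {j : Fin n} {s₁ s₂ : ℝ}
    (hs₁ : Ω.left j < s₁ ∧ s₁ < Ω.right j) (hs₂ : Ω.left j < s₂ ∧ s₂ < s₁)
    (hw₁ : (Ω.piece j s₁).WellPosed lam) (hw₂ : (Ω.tpiece₁ j s₁ j s₂).WellPosed lam)
    (hw₃ : (Ω.tpiece₂ j s₁ j s₂).WellPosed lam) :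
    ∃ M : Matrix (Fin 2) (Fin 2) ℂ,
      (∀ f : Fin 2 → ℂ, M *ᵥ f = Ω.oneWireMap₁ j s₁ s₂ lam f + Ω.oneWireMap₂ j s₁ s₂ lam f) ∧
      Ω.evans lam /
          ((Ω.piece j s₁).evans lam * (Ω.tpiece₁ j s₁ j s₂).evans lam *
            (Ω.tpiece₂ j s₁ j s₂).evans lam) = M.det := by
  have hr₁ : (Ω.inner j s₁).right j = s₁ := by simp [inner]
  have hr₂ : (Ω.tpiece₂ j s₁ j s₂).right j = s₂ := by simp [tpiece₂, inner]
  have hA₁ : (Ω.piece j s₁).IsRegular := hΩ.outer j hs₁.1 hs₁.2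
  have hΩ' := hΩ.inner j hs₁.1 hs₁.2
  have hA₂ : (Ω.tpiece₁ j s₁ j s₂).IsRegular := hΩ'.outer j hs₂.1 (by rw [hr₁]; exact hs₂.2)
  have hB : (Ω.tpiece₂ j s₁ j s₂).IsRegular := hΩ'.inner j hs₂.1 (by rw [hr₁]; exact hs₂.2)
  have hq := hΩ.integrableOn_coeff lam j
  have hq' : IntegrableOn (fun t => Ω.V j t - lam) (Icc s₂ s₁) :=
    hq.mono_set (Icc_subset_Icc hs₂.1.le hs₁.2.le)
  have hm₁ : s₁ ∈ Icc s₂ s₁ := right_mem_Icc.2 hs₂.2.le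
  have hm₂ : s₂ ∈ Icc s₂ s₁ := left_mem_Icc.2 hs₂.2.le
  obtain ⟨z, z', hz⟩ := exists_isOuterSol hΩ lam
  -- `θ` is the outer solution of the middle interval, whose condition at `s₁` is Dirichlet; `η`
  -- completes it to a basis.
  obtain ⟨θ, θ', hθ, hθ₀, hθ₁⟩ := exists_isSol hs₂.2 hq' hm₁ 0 1
  obtain ⟨η, η', hη, hη₀, hη₁⟩ := exists_isSol hs₂.2 hq' hm₁ 1 0
  have hzA : IsSol (fun t => Ω.V j t - lam) s₁ (Ω.right j) (z j) (z' j) :=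
    (hz j).isSol.mono hq hs₁.1.le le_rfl
  have hzC : IsSol (fun t => Ω.V j t - lam) s₂ s₁ (z j) (z' j) :=
    (hz j).isSol.mono hq hs₂.1.le hs₁.2.le
  have hsol : ∀ {u v : ℝ → ℂ}, IsSol (fun t => Ω.V j t - lam) s₂ s₁ u v →
      IsSol (fun t => (Ω.inner j s₁).V j t - lam) s₂ ((Ω.inner j s₁).right j) u v := by
    intro u v h
    rw [hr₁]
    exact h
  have hE₁ : (Ω.piece j s₁).evans lam = -z j s₁ :=
    evans_outer hA₁ hzA (hz j).right_eq (hz j).deriv_right_eq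
  have hE₂ : (Ω.tpiece₁ j s₁ j s₂).evans lam = -θ s₂ :=
    evans_outer hA₂ (hsol hθ) (by rw [hr₁, hθ₀]; simp [inner]) (by rw [hr₁, hθ₁]; simp [inner])
  have hz₀ : z j s₁ ≠ 0 := by
    have := evans_ne_zero hA₁ hw₁
    rwa [hE₁, neg_ne_zero] at this
  have hθ₂ : θ s₂ ≠ 0 := by
    have := evans_ne_zero hA₂ hw₂
    rwa [hE₂, neg_ne_zero] at this
  have hE₃ := evans_ne_zero hB hw₃
  -- The second cut overwrites the first, so the inner star differs from `Ω` on edge `j` alone.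
  obtain ⟨N, hN, hdet, -⟩ := exists_dirichletToNeumann (s := {j}) hΩ hB hw₃ rfl rfl rfl rfl
    (fun i => by
      rcases eq_or_ne i j with rfl | hi
      · rw [hr₂]; exact (hs₂.2.trans hs₁.2).le
      · simp [tpiece₂, inner, hi])
    (fun i hi => by obtain rfl : i = j := hi; simp [tpiece₂, inner])
    (fun i hi => by
      have hi : i ≠ j := hi
      simp [tpiece₂, inner, hi]) hz
  replace hdet := hdet j rfl
  rw [hr₂] at hdet
  obtain ⟨hzs, hzs'⟩ := hzC.eq_of_eq (hη.linComb hθ hq' (z j s₁) (z' j s₁)) hs₂.2 hq' hm₁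
    (by rw [hη₀, hθ₀]; ring) (by rw [hη₁, hθ₁]; ring) hm₂
  have hW := hη.wronskian_eq hθ hs₂.2 hq' hm₂ hm₁
  rw [hη₀, hη₁, hθ₀, hθ₁] at hW
  -- The terms without `z` and `N` form the matrix for `[s₂, s₁]`. Its lower left entry is `(η θ' -
  -- η' θ) / θ` at `s₂`, and `hW` makes the numerator 1.
  refine ⟨!![-(η s₂ / θ s₂) - z' j s₁ / z j s₁, 1 / θ s₂; 1 / θ s₂, N j j - θ' s₂ / θ s₂],
    fun f => ?_, ?_⟩
  · have hu := hη.linComb hθ hq' (f 0) ((f 1 - f 0 * η s₂) / θ s₂)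
    have hD : ∀ x ∈ Icc s₂ s₁, _ := fun x hx => edgeDeriv_bvpSol_outer hA₂ hw₂ (hsol hu)
      (a := f 0) (b := f 1) (by rw [hr₁, hη₀, hθ₀, hη₁, hθ₁]; simp [inner]) (by field_simp; ring)
      (x := x) (by rwa [hr₁])
    have hu₁ := edgeDeriv_bvpSol_outer hA₁ hw₁ (hzA.const_mul (f 0 / z j s₁)) (a := 0) (b := f 0)
      (by linear_combination (f 0 / z j s₁) * (hz j).outer_condition hΩ)
      (div_mul_cancel₀ _ hz₀) (left_mem_Icc.2 hs₁.2.le)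
    have hu₂ := hN (Pi.single j (f 1)) (fun i hi => Pi.single_eq_of_ne hi _) j rfl
    rw [hr₂] at hu₂
    have e₁ : Ω.oneWireMap₁ j s₁ s₂ lam f =
        ![f 0 * η' s₁ + (f 1 - f 0 * η s₂) / θ s₂ * θ' s₁,
          -(f 0 * η' s₂ + (f 1 - f 0 * η s₂) / θ s₂ * θ' s₂)] := by
      rw [← hD s₁ hm₁, ← hD s₂ hm₂]
      rfl
    have e₂ : Ω.oneWireMap₂ j s₁ s₂ lam f =
        ![-(f 0 / z j s₁ * z' j s₁), (N *ᵥ Pi.single j (f 1)) j] := by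
      rw [← hu₁, ← hu₂]
      rfl
    have hNj : (N *ᵥ Pi.single j (f 1)) j = N j j * f 1 := by simp [Matrix.mulVec_single]
    rw [e₁, e₂, hη₁, hθ₁, hNj]
    ext t
    fin_cases t
    · simp [Matrix.mulVec, dotProduct]
      field_simp
      ring
    · simp [Matrix.mulVec, dotProduct]
      field_simp
      linear_combination -f 0 * hW
  · rw [hdet, hE₁, hE₂, hzs, hzs', Matrix.det_fin_two_of]
    field_simp
    -- With `z`, `z'` at `s₂` expanded in `η`, `θ`, the two sides differ only by a multiple of the
    -- Wronskian relation.
    linear_combination -z j s₁ * hW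

/-- Two cuts on different wires. -/
lemma exists_matrix_of_two_wires (hΩ : Ω.IsRegular) {j₁ j₂ : Fin n} (hj : j₁ ≠ j₂) {s₁ s₂ : ℝ}
    (hs₁ : Ω.left j₁ < s₁ ∧ s₁ < Ω.right j₁) (hs₂ : Ω.left j₂ < s₂ ∧ s₂ < Ω.right j₂)
    (hw₁ : (Ω.piece j₁ s₁).WellPosed lam) (hw₂ : (Ω.tpiece₁ j₁ s₁ j₂ s₂).WellPosed lam)
    (hw₃ : (Ω.tpiece₂ j₁ s₁ j₂ s₂).WellPosed lam) :
    ∃ M : Matrix (Fin 2) (Fin 2) ℂ,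
      (∀ f : Fin 2 → ℂ, M *ᵥ f =
        Ω.twoWireMap₁ j₁ s₁ j₂ s₂ lam f + Ω.twoWireMap₂ j₁ s₁ j₂ s₂ lam f) ∧
      Ω.evans lam /
          ((Ω.piece j₁ s₁).evans lam * (Ω.tpiece₁ j₁ s₁ j₂ s₂).evans lam *
            (Ω.tpiece₂ j₁ s₁ j₂ s₂).evans lam) = M.det := by
  have hr : (Ω.inner j₁ s₁).right j₂ = Ω.right j₂ := by simp [inner, hj.symm]
  have hβ₁ : (Ω.inner j₁ s₁).β₁ j₂ j₂ = Ω.β₁ j₂ j₂ := by simp [inner, hj.symm]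
  have hβ₂ : (Ω.inner j₁ s₁).β₂ j₂ j₂ = Ω.β₂ j₂ j₂ := by simp [inner, hj.symm]
  have hr₁ : (Ω.tpiece₂ j₁ s₁ j₂ s₂).right j₁ = s₁ := by simp [tpiece₂, inner, hj]
  have hr₂ : (Ω.tpiece₂ j₁ s₁ j₂ s₂).right j₂ = s₂ := by simp [tpiece₂, inner]
  have hA₁ : (Ω.piece j₁ s₁).IsRegular := hΩ.outer j₁ hs₁.1 hs₁.2
  have hΩ' := hΩ.inner j₁ hs₁.1 hs₁.2
  have hA₂ : (Ω.tpiece₁ j₁ s₁ j₂ s₂).IsRegular := hΩ'.outer j₂ hs₂.1 (by rw [hr]; exact hs₂.2)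
  have hB : (Ω.tpiece₂ j₁ s₁ j₂ s₂).IsRegular := hΩ'.inner j₂ hs₂.1 (by rw [hr]; exact hs₂.2)
  obtain ⟨z, z', hz⟩ := exists_isOuterSol hΩ lam
  have hzA : IsSol (fun t => Ω.V j₁ t - lam) s₁ (Ω.right j₁) (z j₁) (z' j₁) :=
    (hz j₁).isSol.mono (hΩ.integrableOn_coeff lam j₁) hs₁.1.le le_rfl
  have hzC : IsSol (fun t => (Ω.inner j₁ s₁).V j₂ t - lam) s₂ ((Ω.inner j₁ s₁).right j₂)
      (z j₂) (z' j₂) := by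
    rw [hr]
    exact (hz j₂).isSol.mono (hΩ.integrableOn_coeff lam j₂) hs₂.1.le le_rfl
  have hE₁ : (Ω.piece j₁ s₁).evans lam = -z j₁ s₁ :=
    evans_outer hA₁ hzA (hz j₁).right_eq (hz j₁).deriv_right_eq
  have hE₂ : (Ω.tpiece₁ j₁ s₁ j₂ s₂).evans lam = -z j₂ s₂ :=
    evans_outer hA₂ hzC (by rw [hr, hβ₂, (hz j₂).right_eq])
      (by rw [hr, hβ₁, (hz j₂).deriv_right_eq])
  have hz₁ : z j₁ s₁ ≠ 0 := by
    have := evans_ne_zero hA₁ hw₁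
    rwa [hE₁, neg_ne_zero] at this
  have hz₂ : z j₂ s₂ ≠ 0 := by
    have := evans_ne_zero hA₂ hw₂
    rwa [hE₂, neg_ne_zero] at this
  have hE₃ := evans_ne_zero hB hw₃
  obtain ⟨N, hN, -, hdet⟩ := exists_dirichletToNeumann (s := {j₁, j₂}) hΩ hB hw₃ rfl rfl rfl rfl
    (fun i => by
      rcases eq_or_ne i j₂ with rfl | hi₂
      · rw [hr₂]; exact hs₂.2.le
      · rcases eq_or_ne i j₁ with rfl | hi₁
        · rw [hr₁]; exact hs₁.2.le
        · simp [tpiece₂, inner, hi₁, hi₂])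
    (fun i hi => by
      obtain rfl | rfl : i = j₁ ∨ i = j₂ := hi
      · simp [tpiece₂, inner, hj]
      · simp [tpiece₂, inner])
    (fun i hi => by
      obtain ⟨hi₁, hi₂⟩ : i ≠ j₁ ∧ i ≠ j₂ := by simpa using hi
      simp [tpiece₂, inner, hi₁, hi₂]) hz
  replace hdet := hdet j₁ j₂ hj rfl
  rw [hr₁, hr₂] at hdet
  -- The cut-off pieces do not interact, so they contribute only to the diagonal; the coupling of
  -- the wires through the central vertex is in `N`.
  refine ⟨!![N j₁ j₁ - z' j₁ s₁ / z j₁ s₁, N j₁ j₂; N j₂ j₁, N j₂ j₂ - z' j₂ s₂ / z j₂ s₂],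
    fun f => ?_, ?_⟩
  · have hu₁ := edgeDeriv_bvpSol_outer hA₁ hw₁ (hzA.const_mul (f 0 / z j₁ s₁)) (a := 0)
      (b := f 0) (by linear_combination (f 0 / z j₁ s₁) * (hz j₁).outer_condition hΩ)
      (div_mul_cancel₀ _ hz₁) (left_mem_Icc.2 hs₁.2.le)
    have hu₂ := edgeDeriv_bvpSol_outer hA₂ hw₂ (hzC.const_mul (f 1 / z j₂ s₂)) (a := 0)
      (b := f 1) (by
        rw [hr, hβ₁, hβ₂]
        linear_combination (f 1 / z j₂ s₂) * (hz j₂).outer_condition hΩ)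
      (div_mul_cancel₀ _ hz₂) (left_mem_Icc.2 (by rw [hr]; exact hs₂.2.le))
    have hg : ∀ i ∉ ({j₁, j₂} : Set (Fin n)),
        (Pi.single j₁ (f 0) + Pi.single j₂ (f 1) : Fin n → ℂ) i = 0 := fun i hi => by
      obtain ⟨hi₁, hi₂⟩ : i ≠ j₁ ∧ i ≠ j₂ := by simpa using hi
      simp [hi₁, hi₂]
    have hv₁ := hN _ hg j₁ (by simp)
    have hv₂ := hN _ hg j₂ (by simp)
    rw [hr₁] at hv₁
    rw [hr₂] at hv₂
    have e₁ : Ω.twoWireMap₁ j₁ s₁ j₂ s₂ lam f =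
        ![-(f 0 / z j₁ s₁ * z' j₁ s₁), -(f 1 / z j₂ s₂ * z' j₂ s₂)] := by
      rw [← hu₁, ← hu₂]
      rfl
    have e₂ : Ω.twoWireMap₂ j₁ s₁ j₂ s₂ lam f =
        ![(N *ᵥ (Pi.single j₁ (f 0) + Pi.single j₂ (f 1))) j₁,
          (N *ᵥ (Pi.single j₁ (f 0) + Pi.single j₂ (f 1))) j₂] := by
      rw [← hv₁, ← hv₂]
      rfl
    rw [e₁, e₂, Matrix.mulVec_add]
    ext t
    fin_cases t <;> simp [Matrix.mulVec, dotProduct] <;> ring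
  · rw [hdet, hE₁, hE₂, Matrix.det_fin_two_of]
    field_simp
    ring

end Cuts

end StarGraph

end

theorem mainTheorem3 {n : ℕ} (Ω : StarGraph n) (hΩ : Ω.IsAdmissible)
    (hleft : ∀ i, Ω.left i = 0)
    (j₁ j₂ : Fin n) (s₁ s₂ : ℝ)
    (hs₁ : 0 < s₁ ∧ s₁ < Ω.right j₁)
    (hs₂ : 0 < s₂ ∧ s₂ < (Ω.inner j₁ s₁).right j₂)
    (lam : ℂ)
    (hlam₁ : lam ∈ (Ω.piece j₁ s₁).resolventSet)
    (hlam₂ : lam ∈ (Ω.tpiece₁ j₁ s₁ j₂ s₂).resolventSet)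
    (hlam₃ : lam ∈ (Ω.tpiece₂ j₁ s₁ j₂ s₂).resolventSet) :
    -- the boundary value problems that define the maps are uniquely solvable
    ((Ω.piece j₁ s₁).WellPosed lam ∧ (Ω.tpiece₁ j₁ s₁ j₂ s₂).WellPosed lam ∧
      (Ω.tpiece₂ j₁ s₁ j₂ s₂).WellPosed lam) ∧
    -- the denominator does not vanish
    ((Ω.piece j₁ s₁).evans lam ≠ 0 ∧ (Ω.tpiece₁ j₁ s₁ j₂ s₂).evans lam ≠ 0 ∧
      (Ω.tpiece₂ j₁ s₁ j₂ s₂).evans lam ≠ 0) ∧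
    -- the two-sided map is linear, and its determinant is the quotient of Evans functions
    ∃ M : Matrix (Fin 2) (Fin 2) ℂ,
      (∀ f : Fin 2 → ℂ, M *ᵥ f = Ω.twoSidedMap j₁ s₁ j₂ s₂ lam f) ∧
      Ω.evans lam /
          ((Ω.piece j₁ s₁).evans lam * (Ω.tpiece₁ j₁ s₁ j₂ s₂).evans lam *
            (Ω.tpiece₂ j₁ s₁ j₂ s₂).evans lam) = M.det := by
  have hreg := hΩ.isRegular
  have hl₁ : Ω.left j₁ < s₁ := by rw [hleft]; exact hs₁.1
  have hl₂ : Ω.left j₂ < s₂ := by rw [hleft]; exact hs₂.1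
  have hreg' := hreg.inner j₁ hl₁ hs₁.2
  have hA₁ : (Ω.piece j₁ s₁).IsRegular := hreg.outer j₁ hl₁ hs₁.2
  have hA₂ : (Ω.tpiece₁ j₁ s₁ j₂ s₂).IsRegular := hreg'.outer j₂ hl₂ hs₂.2
  have hB : (Ω.tpiece₂ j₁ s₁ j₂ s₂).IsRegular := hreg'.inner j₂ hl₂ hs₂.2
  have hw₁ := StarGraph.wellPosed_of_mem_resolventSet hA₁ hlam₁
  have hw₂ := StarGraph.wellPosed_of_mem_resolventSet hA₂ hlam₂
  have hw₃ := StarGraph.wellPosed_of_mem_resolventSet hB hlam₃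
  refine ⟨⟨hw₁, hw₂, hw₃⟩, ⟨StarGraph.evans_ne_zero hA₁ hw₁, StarGraph.evans_ne_zero hA₂ hw₂,
    StarGraph.evans_ne_zero hB hw₃⟩, ?_⟩
  rcases eq_or_ne j₁ j₂ with rfl | hj
  · obtain ⟨M, hM, hdet⟩ := StarGraph.exists_matrix_of_one_wire hreg ⟨hl₁, hs₁.2⟩
      ⟨hl₂, by simpa [StarGraph.inner] using hs₂.2⟩ hw₁ hw₂ hw₃
    exact ⟨M, fun f => by rw [hM, StarGraph.twoSidedMap, if_pos rfl], hdet⟩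
  · obtain ⟨M, hM, hdet⟩ := StarGraph.exists_matrix_of_two_wires hreg hj ⟨hl₁, hs₁.2⟩
      ⟨hl₂, by simpa [StarGraph.inner, hj.symm] using hs₂.2⟩ hw₁ hw₂ hw₃
    exact ⟨M, fun f => by rw [hM, StarGraph.twoSidedMap, if_neg hj], hdet⟩
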